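/- **Theorem (stochastic setting with convex upper level).** *Problem.* Let $d\ge 1$, $\mathcal Z\subset\mathbb R^d$, let $\theta\sim P$, $\xi\sim Q$ be random samples, and let $f(x)=\mathbb E[\tilde f(x,\theta)]$, $g(x)=\mathbb E[\tilde g(x,\xi)]$. Put $g^*=\min_{z\in\mathcal Z} g(z)$, $\mathcal X_g^*=\operatorname{argmin}_{z\in\mathcal Z} g(z)$ and $f^*=\min_{x\in\mathcal X_g^*} f(x)$. Assume that 1. $\mathcal Z$ is convex and compact, and $\|x-y\|\le D$ for all $x,y\in\mathcal Z$; 2. $\tilde f,\tilde g$ are jointly measurable; on $\mathcal Z$ the expectations $f,g$ exist, and $\tilde f(\cdot,\theta)$, $\tilde g(\cdot,\xi)$, $f$, $g$ are differentiable at every point of $\mathcal Z$; 3. $\|\nabla\tilde f(x,\theta)-\nabla\tilde f(y,\theta)\|\le L_f\|x-y\|$ for all $x,y\in\mathcal Z$ and all $\theta$, and $\mathbb E\exp(\|\nabla\tilde f(x,\theta)-\nabla f(x)\|^2/\sigma_f^2)\le e$ for all $x\in\mathcal Z$; 4. $g$ is convex on $\mathcal Z$, $\|\nabla\tilde g(x,\xi)-\nabla\tilde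 g(y,\xi)\|\le L_g\|x-y\|$ for all $x,y\in\mathcal Z$ and all $\xi$, and $\mathbb E\exp(\|\nabla\tilde g(x,\xi)-\nabla g(x)\|^2/\sigma_g^2)\le e$, $\mathbb E\exp(|\tilde g(x,\xi)-g(x)|^2/\sigma_l^2)\le e$ for all $x\in\mathcal Z$; 5. $f$ is convex on $\mathcal Z$; where $L_f,L_g\ge0$ and $\sigma_f,\sigma_g,\sigma_l>0$. Let $L_l\ge0$ be a Lipschitz constant of $g$ on $\mathcal Z$. *Algorithm (SBCGI).* Start from $x_0\in\mathcal Z$ with $g(x_0)-g^*\le\epsilon_g/2$. At each iteration $t=0,1,2,\dots$ draw one pair of samples $(\theta_t,\xi_t)$, with $\theta_t\sim P$ and $\xi_t\sim Q$, independent of the past of the algorithm, and form the STORM estimators: for $t=0$, $\widehat{\nabla f}_0=\nabla\tilde f(x_0,\theta_0)$, $\widehat{\nabla g}_0=\nabla\tilde g(x_0,\xi_0)$, $\hat g_0=\tilde g(x_0,\xi_0)$, and for $t\ge1$ $$\widehat{\nabla f}_t=(1-\alpha_t)\widehat{\nabla f}_{t-1}+\nabla\tilde f(x_t,\theta_t)-(1-\alpha_t)\nabla\tilde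 f(x_{t-1},\theta_t),$$ $$\widehat{\nabla g}_t=(1-\beta_t)\widehat{\nabla g}_{t-1}+\nabla\tilde g(x_t,\xi_t)-(1-\beta_t)\nabla\tilde g(x_{t-1},\xi_t),\qquad \hat g_t=(1-\rho_t)\hat g_{t-1}+\tilde g(x_t,\xi_t)-(1-\rho_t)\tilde g(x_{t-1},\xi_t).$$ Then a linear minimization oracle returns $$s_t\in\operatorname*{argmin}_{s\in\hat{\mathcal X}_t}\langle\widehat{\nabla f}_t,s\rangle,\qquad \hat{\mathcal X}_t=\{s\in\mathcal Z:\langle\widehat{\nabla g}_t,s-x_t\rangle\le g(x_0)-\hat g_t+K_t\},$$ (an arbitrary value, depending measurably on the past, if $\hat{\mathcal X}_t=\emptyset$) and $x_{t+1}=(1-\gamma_{t+1})x_t+\gamma_{t+1}s_t$. Take $\alpha_t=\beta_t=\rho_t=\gamma_t=1/(t+1)$ and, for $\delta\in(0,1)$ and with $\bar t=\max\{t,1\}$, $$K_t=\frac{c}{\sqrt{t+1}}\Big(\big(2L_lD+\tfrac32\sigma_l\big)\sqrt{2\log(6\bar t/\delta)}+D\big(2L_gD+\tfrac32\sigma_g\big)\sqrt{2\log(6\bar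 t d/\delta)}\Big).$$ *Claim.* There is an absolute constant $c>0$ (depending on nothing) such that the following hold with this $c$ in $K_t$. (a) With probability at least $1-\delta$, all subproblems are feasible ($\hat{\mathcal X}_t\ne\emptyset$ for all $t\ge0$) and, simultaneously for all $t\ge1$, with $\zeta=\sqrt{\log(6td/\delta)}$, $$g(x_t)-g^*\le\frac{C_1\zeta}{\sqrt{t+1}}+\frac{L_gD^2\log t}{t+1}+\frac{\epsilon_g}{2},\qquad f(x_t)-f^*\le\frac{C_2\zeta}{\sqrt{t+1}}+\frac{f(x_0)-f^*+L_fD^2\log t}{t+1},$$ where $$C_1=4\sqrt2\,c\Big(D\big(2L_gD+\tfrac32\sigma_g\big)+2L_lD+\tfrac32\sigma_l\Big),\qquad C_2=2\sqrt2\,c\,D\big(2L_fD+\tfrac32\sigma_f\big).$$ (b) (Sample complexity $\tilde O(1/\epsilon^2)$.) For all values of $D,L_f,L_g,L_l,\sigma_f,\sigma_g,\sigma_l$ and every $\Delta\in\mathbb R$ there is $M>0$, depending only on these numbers, such that for all $d\ge1$, $\delta\in(0,1)$ and $\epsilon_f,\epsilon_g>0$ with $\epsilon=\min\{\epsilon_f,\epsilon_g\}\le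 1/2$ there is $T$ such that the first $T$ iterations, which produce $x_T$, draw in total at most $M\log(d/(\delta\epsilon))/\epsilon^2$ samples and, for every problem as above with $f(x_0)-f^*\le\Delta$, with probability at least $1-\delta$ one has $x_t\in\mathcal Z$, $f(x_t)-f^*\le\epsilon_f$ and $g(x_t)-g^*\le\epsilon_g$ for all $t\ge T$. -/

import Mathlib

open MeasureTheory ProbabilityTheory

noncomputable section

namespace SimpleBilevel

/-- The Euclidean space `ℝ^d`. -/
abbrev Vec (d : ℕ) : Type := EuclideanSpace ℝ (Fin d)

/-- Data of a stochastic simple bilevel problem: minimise `f x = E[F(x, θ)]` over the minimisers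
of `g x = E[G(x, ξ)]` on the set `Z`, where `θ ∼ P` and `ξ ∼ Q`. -/
structure Problem (d : ℕ) (Θ Ξ : Type*) [MeasurableSpace Θ] [MeasurableSpace Ξ] where
  Z : Set (Vec d)
  P : Measure Θ
  Q : Measure Ξ
  F : Vec d → Θ → ℝ
  G : Vec d → Ξ → ℝ

namespace Problem

variable {d : ℕ} {Θ Ξ : Type*} [MeasurableSpace Θ] [MeasurableSpace Ξ] (p : Problem d Θ Ξ)

/-- The upper-level objective `f x = E[F(x, θ)]`. -/
def f (x : Vec d) : ℝ := ∫ θ, p.F x θ ∂p.P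

/-- The lower-level objective `g x = E[G(x, ξ)]`. -/
def g (x : Vec d) : ℝ := ∫ ξ, p.G x ξ ∂p.Q

/-- The stochastic gradient `∇F(x, θ)` with respect to `x`. -/
def gradF (x : Vec d) (θ : Θ) : Vec d := gradient (fun y => p.F y θ) x

/-- The stochastic gradient `∇G(x, ξ)` with respect to `x`. -/
def gradG (x : Vec d) (ξ : Ξ) : Vec d := gradient (fun y => p.G y ξ) x

/-- The lower-level optimal value `g* = min_{z ∈ Z} g z`. -/
def gStar : ℝ := sInf (p.g '' p.Z)

/-- The lower-level solution set `argmin_{z ∈ Z} g z`. -/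
def lowerSol : Set (Vec d) := {z | z ∈ p.Z ∧ ∀ y ∈ p.Z, p.g z ≤ p.g y}

/-- The optimal value `f*` of the bilevel problem. -/
def fStar : ℝ := sInf (p.f '' p.lowerSol)

/-- `(ε_f, ε_g)`-optimality of a point. -/
def IsOptimal (εf εg : ℝ) (x : Vec d) : Prop :=
  x ∈ p.Z ∧ p.f x - p.fStar ≤ εf ∧ p.g x - p.gStar ≤ εg

end Problem

/-- The constants: diameter bound, smoothness and Lipschitz constants, noise levels. -/
structure Constants where
  D : ℝ
  Lf : ℝ
  Lg : ℝ
  Ll : ℝ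
  σf : ℝ
  σg : ℝ
  σl : ℝ

/-- `E[exp(‖X‖² / σ²)] ≤ exp 1`; the expectation is taken in `[0, ∞]`, so that the inequality
contains the finiteness of the exponential moment. -/
def SubGaussianNoise {S V : Type*} [MeasurableSpace S] [NormedAddCommGroup V]
    (P : Measure S) (X : S → V) (σ : ℝ) : Prop :=
  ∫⁻ z, ENNReal.ofReal (Real.exp (‖X z‖ ^ 2 / σ ^ 2)) ∂P ≤ ENNReal.ofReal (Real.exp 1)

/-- The standing assumptions on the problem. -/
structure Assumptions {d : ℕ} {Θ Ξ : Type*} [MeasurableSpace Θ] [MeasurableSpace Ξ]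
    (p : Problem d Θ Ξ) (k : Constants) : Prop where
  -- the feasible set
  convex_Z : Convex ℝ p.Z
  compact_Z : IsCompact p.Z
  diam_Z : ∀ x ∈ p.Z, ∀ y ∈ p.Z, ‖x - y‖ ≤ k.D
  -- well-posedness of the expectations and gradients (unbiasedness of the stochastic gradients
  -- is not assumed)
  prob_P : IsProbabilityMeasure p.P
  prob_Q : IsProbabilityMeasure p.Q
  meas_F : Measurable (Function.uncurry p.F)
  meas_G : Measurable (Function.uncurry p.G)
  int_F : ∀ x ∈ p.Z, Integrable (p.F x) p.P
  int_G : ∀ x ∈ p.Z, Integrable (p.G x) p.Q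
  diff_F : ∀ θ, ∀ x ∈ p.Z, DifferentiableAt ℝ (fun y => p.F y θ) x
  diff_G : ∀ ξ, ∀ x ∈ p.Z, DifferentiableAt ℝ (fun y => p.G y ξ) x
  diff_f : ∀ x ∈ p.Z, DifferentiableAt ℝ p.f x
  diff_g : ∀ x ∈ p.Z, DifferentiableAt ℝ p.g x
  -- admissible constants
  Lf_nonneg : 0 ≤ k.Lf
  Lg_nonneg : 0 ≤ k.Lg
  Ll_nonneg : 0 ≤ k.Ll
  σf_pos : 0 < k.σf
  σg_pos : 0 < k.σg
  σl_pos : 0 < k.σl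
  -- the upper level
  smooth_F : ∀ θ, ∀ x ∈ p.Z, ∀ y ∈ p.Z, ‖p.gradF x θ - p.gradF y θ‖ ≤ k.Lf * ‖x - y‖
  noise_gradF : ∀ x ∈ p.Z,
    SubGaussianNoise p.P (fun θ => p.gradF x θ - gradient p.f x) k.σf
  -- the lower level
  convex_g : ConvexOn ℝ p.Z p.g
  smooth_G : ∀ ξ, ∀ x ∈ p.Z, ∀ y ∈ p.Z, ‖p.gradG x ξ - p.gradG y ξ‖ ≤ k.Lg * ‖x - y‖
  noise_gradG : ∀ x ∈ p.Z,
    SubGaussianNoise p.Q (fun ξ => p.gradG x ξ - gradient p.g x) k.σg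
  noise_G : ∀ x ∈ p.Z, SubGaussianNoise p.Q (fun ξ => p.G x ξ - p.g x) k.σl
  lipschitz_g : ∀ x ∈ p.Z, ∀ y ∈ p.Z, |p.g x - p.g y| ≤ k.Ll * ‖x - y‖

/-- The STORM estimator of a stochastic map `h` along the points `x t`, with samples `z t` and
momentum weights `a t`. -/
def storm {X S V : Type*} [AddCommGroup V] [Module ℝ V]
    (a : ℕ → ℝ) (h : X → S → V) (x : ℕ → X) (z : ℕ → S) : ℕ → V
  | 0 => h (x 0) (z 0)
  | t + 1 => (1 - a (t + 1)) • storm a h x z t + h (x (t + 1)) (z (t + 1))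
      - (1 - a (t + 1)) • h (x t) (z (t + 1))

/-- Frank–Wolfe iterates `x_{t+1} = (1 - γ_{t+1}) x_t + γ_{t+1} s_t`. -/
def iterate {d : ℕ} (γ : ℕ → ℝ) (x₀ : Vec d) (s : ℕ → Vec d) : ℕ → Vec d
  | 0 => x₀
  | t + 1 => (1 - γ (t + 1)) • iterate γ x₀ s t + γ (t + 1) • s t

/-- The inputs of SBCGI: step sizes, cutting-plane shifts and the initial point. -/
structure Input (d : ℕ) where
  α : ℕ → ℝ
  β : ℕ → ℝ
  ρ : ℕ → ℝ
  γ : ℕ → ℝ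
  K : ℕ → ℝ
  x₀ : Vec d

section Algorithm

variable {d : ℕ} {Θ Ξ : Type*} [MeasurableSpace Θ] [MeasurableSpace Ξ]

/-- The feasible set of the subproblem of iteration `t`,
`{s ∈ Z : ⟪v_t, s - x_t⟫ ≤ g(x₀) - ĝ_t + K_t}`, as a function of the samples `ξ` and of the
directions `s` used so far; `v_t` and `ĝ_t` are the STORM estimates of `∇g(x_t)` and `g(x_t)`. -/
def feasibleSet (p : Problem d Θ Ξ) (inp : Input d) (ξ : ℕ → Ξ) (s : ℕ → Vec d) (t : ℕ) :
    Set (Vec d) :=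
  let x := iterate inp.γ inp.x₀ s
  {y | y ∈ p.Z ∧ inner ℝ (storm inp.β p.gradG x ξ t) (y - x t) ≤
    p.g inp.x₀ - storm inp.ρ p.G x ξ t + inp.K t}

/-- A (random) run of SBCGI on the probability space `(Ω, μ)`. At iteration `t` a fresh pair of
samples `(θ t, ξ t)` is drawn, with `θ t ∼ P` and `ξ t ∼ Q`, and then a linear minimisation oracle
returns the direction `s t`; `ℱ t` is the information available after iteration `t`. If the
subproblem is infeasible, then nothing is required of the value of `s t`. -/
structure IsRun (p : Problem d Θ Ξ) (inp : Input d) {Ω : Type*} [m : MeasurableSpace Ω]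
    (μ : Measure Ω) (ℱ : Filtration ℕ m) (θ : ℕ → Ω → Θ) (ξ : ℕ → Ω → Ξ)
    (s : ℕ → Ω → Vec d) : Prop where
  meas_θ : ∀ t, Measurable[ℱ t] (θ t)
  meas_ξ : ∀ t, Measurable[ℱ t] (ξ t)
  meas_s : ∀ t, Measurable[ℱ t] (s t)
  law_θ : ∀ t, μ.map (θ t) = p.P
  law_ξ : ∀ t, μ.map (ξ t) = p.Q
  fresh : ∀ t, Indep (MeasurableSpace.comap (fun ω => (θ (t + 1) ω, ξ (t + 1) ω)) inferInstance)
    (ℱ t) μ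
  oracle : ∀ t ω, (feasibleSet p inp (fun i => ξ i ω) (fun i => s i ω) t).Nonempty →
    s t ω ∈ feasibleSet p inp (fun i => ξ i ω) (fun i => s i ω) t ∧
    ∀ y ∈ feasibleSet p inp (fun i => ξ i ω) (fun i => s i ω) t,
      inner ℝ (storm inp.α p.gradF (iterate inp.γ inp.x₀ (fun i => s i ω)) (fun i => θ i ω) t)
          (s t ω) ≤
        inner ℝ (storm inp.α p.gradF (iterate inp.γ inp.x₀ (fun i => s i ω)) (fun i => θ i ω) t)
          y

end Algorithm

/-- The cutting-plane shift `K_t`; the logarithms are evaluated at `max t 1`, because the formula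
with `t` is undefined for `t = 0`. -/
def shift (k : Constants) (c : ℝ) (d : ℕ) (δ : ℝ) (t : ℕ) : ℝ :=
  c * ((2 * k.Ll * k.D + 3 / 2 * k.σl) * √(2 * Real.log (6 * (max t 1 : ℕ) / δ))
      + k.D * (2 * k.Lg * k.D + 3 / 2 * k.σg) * √(2 * Real.log (6 * (max t 1 : ℕ) * d / δ)))
    / √((t : ℝ) + 1)

/-- SBCGI inputs with `α_t = β_t = ρ_t = γ_t = 1/(t+1)` and the shift `K_t`. -/
def stdInput (k : Constants) (c : ℝ) {d : ℕ} (δ : ℝ) (x₀ : Vec d) : Input d where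
  α t := 1 / ((t : ℝ) + 1)
  β t := 1 / ((t : ℝ) + 1)
  ρ t := 1 / ((t : ℝ) + 1)
  γ t := 1 / ((t : ℝ) + 1)
  K := shift k c d δ
  x₀ := x₀

/-- The factor `ζ = √(log(6td/δ))`. -/
def zeta (d : ℕ) (δ : ℝ) (t : ℕ) : ℝ := √(Real.log (6 * t * d / δ))

/-- The constant `C₁` of the lower-level bound. -/
def lowerConst (k : Constants) (c : ℝ) : ℝ :=
  4 * √2 * c * (k.D * (2 * k.Lg * k.D + 3 / 2 * k.σg) + (2 * k.Ll * k.D + 3 / 2 * k.σl))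

/-- The constant `C₂` of the upper-level bound. -/
def upperConst (k : Constants) (c : ℝ) : ℝ :=
  2 * √2 * c * k.D * (2 * k.Lf * k.D + 3 / 2 * k.σf)

/-- The number of samples drawn for the computation of `x_T`: one sample of `θ` and one of `ξ` in
each of the iterations `0, …, T - 1`. -/
def sampleCount (T : ℕ) : ℕ := ∑ _t ∈ Finset.range T, (1 + 1)

end SimpleBilevel

end

/-! With weights `1/(t+1)`, the STORM error multiplied by `t+1` is exactly a sum of increments
`N(x_i, z_i) + i (N(x_i, z_i) - N(x_{i-1}, z_i))`, where `N` is the noise of one sample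
(`smul_storm_sub_eq_sum`). Frank–Wolfe steps satisfy `i ‖x_i - x_{i-1}‖ ≤ D`, so the factor `i` is
harmless and the increments form a martingale difference sequence with a uniform `ψ₂` bound. The
Azuma inequality `measure_norm_sum_sq_gt_le` then makes each error of order `√(log(t/δ)/t)`, and a
union bound over all `t` gives one good event (`le_measure_smallErrors`).

Two points need care. The stochastic gradients are not assumed unbiased and `Z` may have empty
interior, so expectation and gradient commute only along directions of the affine span of `Z`.
Gradient errors are therefore projected by `tangentProj`, which costs nothing because the algorithm
pairs gradients only with differences of points of `Z`. Moreover, an infeasible subproblem may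
return any direction, so concentration is proved for truncated iterates; `mem_of_smallErrors` shows
that on the good event the truncation never acts.

On that event the argument is deterministic. The shift `K_t` dominates the lower-level errors, so by
convexity of `g` every lower-level solution satisfies the cut. The cut bounds `⟪∇g(x_t), s_t - x_t⟫`
by `g(x₀) - g(x_t)` plus errors, while optimality of `s_t` against a bilevel solution and convexity
of `f` bound `⟪∇f(x_t), s_t - x_t⟫` by `f* - f(x_t)` plus errors. Both gaps then obey the recursion
of `rate_of_recursion`. The complexity bound follows by absorbing the logarithms. -/

namespace SimpleBilevel

/-! ### Exponential moments and a dimension-free Azuma inequality. -/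

section Concentration

/-- `X` has sub-Gaussian (Orlicz `ψ₂`) norm at most `τ` under `P`. -/
structure PsiTwo {S : Type*} [MeasurableSpace S] (P : Measure S) (X : S → ℝ) (τ : ℝ) : Prop where
  pos : 0 < τ
  meas : Measurable X
  integrable : Integrable (fun z => Real.exp ((X z / τ) ^ 2)) P
  le : ∫ z, Real.exp ((X z / τ) ^ 2) ∂P ≤ Real.exp 1

theorem exp_le_add_exp_sq (x : ℝ) : Real.exp x ≤ x + Real.exp (x ^ 2) := by
  have h2 : x ^ 2 + 1 ≤ Real.exp (x ^ 2) := Real.add_one_le_exp _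
  rcases le_total |x| 1 with h | h
  · have := Real.abs_exp_sub_one_sub_id_le h
    have := (abs_le.mp this).2
    linarith
  · rcases le_total 0 x with h0 | h0
    · rw [abs_of_nonneg h0] at h
      have : Real.exp x ≤ Real.exp (x ^ 2) := Real.exp_le_exp.mpr (by nlinarith)
      linarith
    · rw [abs_of_nonpos h0] at h
      have : Real.exp x ≤ 1 := Real.exp_le_one_iff.mpr h0
      nlinarith

/-- Convexity of the exponential, as a chord bound. -/
theorem exp_mul_le_affine {κ : ℝ} (h0 : 0 ≤ κ) (h1 : κ ≤ 1) (y : ℝ) :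
    Real.exp (κ * y) ≤ Real.exp κ * (1 - κ + κ * Real.exp (-1) * Real.exp y) := by
  -- The chord runs from `0` to `y - 1`; the shift by one is the normalisation under which `E exp y
  -- ≤ e` gives `E exp (κ y) ≤ exp κ`.
  have h := convexOn_exp.2 (Set.mem_univ (0 : ℝ)) (Set.mem_univ (y - 1)) (sub_nonneg.mpr h1) h0
    (by ring)
  simp only [smul_eq_mul, mul_zero, zero_add, Real.exp_zero, mul_one] at h
  calc Real.exp (κ * y) = Real.exp κ * Real.exp (κ * (y - 1)) := by
        rw [← Real.exp_add]; ring_nf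
    _ ≤ Real.exp κ * (1 - κ + κ * Real.exp (y - 1)) := by gcongr
    _ = _ := by rw [sub_eq_add_neg y 1, Real.exp_add]; ring

variable {S : Type*} [MeasurableSpace S] {P : Measure S} [IsProbabilityMeasure P]

theorem PsiTwo.exp_mul_sq {X : S → ℝ} {τ κ : ℝ} (hX : PsiTwo P X τ) (h0 : 0 ≤ κ) (h1 : κ ≤ 1) :
    Integrable (fun z => Real.exp (κ * (X z / τ) ^ 2)) P ∧
      ∫ z, Real.exp (κ * (X z / τ) ^ 2) ∂P ≤ Real.exp κ := by
  have hb : Integrable (fun z => Real.exp κ *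
      (1 - κ + κ * Real.exp (-1) * Real.exp ((X z / τ) ^ 2))) P :=
    ((integrable_const _).add (hX.integrable.const_mul _)).const_mul _
  have hm := hX.meas
  have hi : Integrable (fun z => Real.exp (κ * (X z / τ) ^ 2)) P := by
    refine hb.mono' (by fun_prop) (Filter.Eventually.of_forall fun z => ?_)
    rw [Real.norm_eq_abs, Real.abs_exp]
    exact exp_mul_le_affine h0 h1 _
  refine ⟨hi, (integral_mono hi hb fun z => exp_mul_le_affine h0 h1 _).trans ?_⟩
  rw [integral_const_mul, integral_add (integrable_const _) (hX.integrable.const_mul _),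
    integral_const_mul, integral_const]
  simp only [probReal_univ, one_smul]
  have : κ * Real.exp (-1) * ∫ z, Real.exp ((X z / τ) ^ 2) ∂P ≤ κ := by
    calc _ ≤ κ * Real.exp (-1) * Real.exp 1 := by gcongr; exact hX.le
      _ = κ := by rw [mul_assoc, ← Real.exp_add]; simp
  calc _ ≤ Real.exp κ * (1 - κ + κ) := by gcongr
    _ = _ := by ring

omit [IsProbabilityMeasure P] in
theorem PsiTwo.integrable_self {X : S → ℝ} {τ : ℝ} (hX : PsiTwo P X τ) : Integrable X P := by
  refine (hX.integrable.const_mul τ).mono' hX.meas.aestronglyMeasurable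
    (Filter.Eventually.of_forall fun z => ?_)
  have hτ := hX.pos
  have h1 := Real.add_one_le_exp ((X z / τ) ^ 2)
  have h2 : |X z| = τ * |X z / τ| := by
    rw [abs_div, abs_of_pos hτ]; field_simp
  rw [Real.norm_eq_abs, h2]
  gcongr
  have := sq_abs (X z / τ)
  nlinarith [sq_nonneg (|X z / τ| - 1), abs_nonneg (X z / τ)]

/-- A centred random variable dominated by a sub-Gaussian one has a Gaussian Laplace transform. -/
theorem PsiTwo.integral_exp_le {X Y : S → ℝ} {τ b : ℝ} (hY : PsiTwo P Y τ) (hX : Measurable X)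
    (hb : 0 ≤ b) (hXY : ∀ z, |X z| ≤ b * |Y z|) (hmean : ∫ z, X z ∂P = 0) :
    Integrable (fun z => Real.exp (X z)) P ∧
      ∫ z, Real.exp (X z) ∂P ≤ Real.exp (b ^ 2 * τ ^ 2) := by
  have hτ := hY.pos
  have hXi : Integrable X P := (hY.integrable_self.norm.const_mul b).mono'
    hX.aestronglyMeasurable (Filter.Eventually.of_forall hXY)
  have hmono : ∀ u : S → ℝ, Integrable u P → (∀ z, Real.exp (X z) ≤ u z) →
      Integrable (fun z => Real.exp (X z)) P := fun u hu h =>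
    hu.mono' (by fun_prop) (Filter.Eventually.of_forall fun z => by
      rw [Real.norm_eq_abs, Real.abs_exp]; exact h z)
  -- For `b τ ≤ 1` the linear term of `exp x ≤ x + exp (x²)` has mean zero. For `b τ ≥ 1` Young's
  -- inequality suffices without centring, since the extra `exp (1/2)` is absorbed by `b² τ² / 2 ≥
  -- 1/2`.
  rcases le_total (b * τ) 1 with h | h
  · have hκ : (b * τ) ^ 2 ≤ 1 := pow_le_one₀ (by positivity) h
    obtain ⟨hi, hle⟩ := hY.exp_mul_sq (sq_nonneg (b * τ)) hκ
    have hpt : ∀ z, Real.exp (X z) ≤ X z + Real.exp ((b * τ) ^ 2 * (Y z / τ) ^ 2) := fun z => by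
      refine (exp_le_add_exp_sq _).trans ?_
      gcongr
      calc X z ^ 2 = |X z| ^ 2 := (sq_abs _).symm
        _ ≤ (b * |Y z|) ^ 2 := by gcongr; exact hXY z
        _ = _ := by rw [mul_pow, sq_abs]; field_simp
    have hint := hmono _ (hXi.add hi) hpt
    refine ⟨hint, (integral_mono hint (hXi.add hi) hpt).trans ?_⟩
    rw [Pi.add_def, integral_add hXi hi, hmean, zero_add, ← mul_pow]
    exact hle
  · obtain ⟨hi, hle⟩ := hY.exp_mul_sq (κ := 1 / 2) (by norm_num) (by norm_num)
    have hpt : ∀ z, Real.exp (X z) ≤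
        Real.exp (b ^ 2 * τ ^ 2 / 2) * Real.exp (1 / 2 * (Y z / τ) ^ 2) := fun z => by
      rw [← Real.exp_add]
      gcongr
      have h1 : X z ≤ (b * τ) * |Y z / τ| := by
        refine (le_abs_self _).trans ((hXY z).trans (le_of_eq ?_))
        rw [abs_div, abs_of_pos hτ]; field_simp
      rw [← sq_abs (Y z / τ)]
      nlinarith [sq_nonneg (b * τ - |Y z / τ|)]
    have hint := hmono _ (hi.const_mul _) hpt
    refine ⟨hint, (integral_mono hint (hi.const_mul _) hpt).trans ?_⟩
    rw [integral_const_mul]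
    calc _ ≤ Real.exp (b ^ 2 * τ ^ 2 / 2) * Real.exp (1 / 2) := by gcongr
      _ ≤ _ := by
        rw [← Real.exp_add]
        gcongr
        nlinarith

variable {V : Type*} [NormedAddCommGroup V] [InnerProductSpace ℝ V] [MeasurableSpace V]
  [BorelSpace V] [SecondCountableTopology V]

/-- Expanding the square leaves a cross term and `‖X‖²`. The cross term is centred, so it
contributes only second order in `a`, namely `8 a² τ² ‖s‖²`. Nothing here depends on the dimension
of `V`. -/
theorem PsiTwo.integral_exp_norm_add_sq_le {X : S → V} {τ a : ℝ}
    (hX : PsiTwo P (fun z => ‖X z‖) τ) (hm : Measurable X)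
    (s : V) (hmean : ∫ z, inner ℝ s (X z) ∂P = 0) (ha : 0 ≤ a) (haτ : 2 * a * τ ^ 2 ≤ 1) :
    Integrable (fun z => Real.exp (a * ‖s + X z‖ ^ 2)) P ∧
      ∫ z, Real.exp (a * ‖s + X z‖ ^ 2) ∂P ≤
        Real.exp (a * τ ^ 2) * Real.exp ((a + 8 * a ^ 2 * τ ^ 2) * ‖s‖ ^ 2) := by
  have hτ := hX.pos
  obtain ⟨i1, l1⟩ := hX.exp_mul_sq (κ := 2 * a * τ ^ 2) (by positivity) haτ
  obtain ⟨i2, l2⟩ := hX.integral_exp_le (X := fun z => 4 * a * inner ℝ s (X z))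
    (b := 4 * a * ‖s‖) (by fun_prop) (by positivity) (fun z => by
      rw [abs_mul, abs_of_nonneg (by positivity : 0 ≤ 4 * a), abs_norm, mul_assoc (4 * a)]
      exact mul_le_mul_of_nonneg_left (abs_real_inner_le_norm s (X z)) (by positivity))
    (by rw [integral_const_mul, hmean, mul_zero])
  set p : ℝ := (4 * a * ‖s‖) ^ 2 * τ ^ 2 with hp
  set q : ℝ := 2 * a * τ ^ 2 with hq
  -- Cauchy–Schwarz in pointwise form: the weights `exp (±(q - p)/2)` equalise the bounds `exp p`
  -- and `exp q` of the two expectations, so that their average is `exp ((p + q)/2)`.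
  set u : S → ℝ := fun z => Real.exp (a * ‖s‖ ^ 2) * (1 / 2 *
    (Real.exp ((q - p) / 2) * Real.exp (4 * a * inner ℝ s (X z)) +
      Real.exp ((p - q) / 2) * Real.exp (q * (‖X z‖ / τ) ^ 2))) with hu
  have hui : Integrable u P := (((i2.const_mul _).add (i1.const_mul _)).const_mul _).const_mul _
  have hpt : ∀ z, Real.exp (a * ‖s + X z‖ ^ 2) ≤ u z := fun z => by
    have e1 : q * (‖X z‖ / τ) ^ 2 = 2 * a * ‖X z‖ ^ 2 := by rw [hq]; field_simp
    have e2 : a * ‖s + X z‖ ^ 2 = a * ‖s‖ ^ 2 +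
        (((q - p) / 2 + 4 * a * inner ℝ s (X z)) / 2 +
          ((p - q) / 2 + q * (‖X z‖ / τ) ^ 2) / 2) := by
      rw [e1, norm_add_sq_real]; ring
    simp only [hu]
    rw [e2, Real.exp_add, ← Real.exp_add ((q - p) / 2), ← Real.exp_add ((p - q) / 2)]
    refine mul_le_mul_of_nonneg_left ?_ (Real.exp_pos _).le
    generalize (q - p) / 2 + 4 * a * inner ℝ s (X z) = A
    generalize (p - q) / 2 + q * (‖X z‖ / τ) ^ 2 = B
    have h1 : Real.exp A = Real.exp (A / 2) ^ 2 := by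
      rw [← Real.exp_nat_mul]; congr 1; push_cast; ring
    have h2 : Real.exp B = Real.exp (B / 2) ^ 2 := by
      rw [← Real.exp_nat_mul]; congr 1; push_cast; ring
    rw [h1, h2, Real.exp_add]
    nlinarith [sq_nonneg (Real.exp (A / 2) - Real.exp (B / 2))]
  have hint : Integrable (fun z => Real.exp (a * ‖s + X z‖ ^ 2)) P :=
    hui.mono' (by fun_prop) (Filter.Eventually.of_forall fun z => by
      rw [Real.norm_eq_abs, Real.abs_exp]; exact hpt z)
  refine ⟨hint, (integral_mono hint hui hpt).trans ?_⟩
  rw [hu, integral_const_mul, integral_const_mul,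
    integral_add (i2.const_mul _) (i1.const_mul _), integral_const_mul, integral_const_mul]
  calc _ ≤ Real.exp (a * ‖s‖ ^ 2) * (1 / 2 *
        (Real.exp ((q - p) / 2) * Real.exp p + Real.exp ((p - q) / 2) * Real.exp q)) := by
        gcongr
    _ = _ := by
        rw [← Real.exp_add, ← Real.exp_add,
          show (q - p) / 2 + p = (p + q) / 2 by ring, show (p - q) / 2 + q = (p + q) / 2 by ring,
          ← two_mul, ← mul_assoc (1 / 2 : ℝ), one_div, inv_mul_cancel₀ two_ne_zero, one_mul,
          ← Real.exp_add, ← Real.exp_add]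
        congr 1
        rw [hp, hq]; ring

theorem PsiTwo.lintegral_exp_norm_add_sq_le {X : S → V} {τ a : ℝ}
    (hX : PsiTwo P (fun z => ‖X z‖) τ) (hm : Measurable X)
    (s : V) (hmean : ∫ z, inner ℝ s (X z) ∂P = 0) (ha : 0 ≤ a) (haτ : 2 * a * τ ^ 2 ≤ 1) :
    ∫⁻ z, ENNReal.ofReal (Real.exp (a * ‖s + X z‖ ^ 2)) ∂P ≤
      ENNReal.ofReal (Real.exp (a * τ ^ 2)) *
        ENNReal.ofReal (Real.exp ((a + 8 * a ^ 2 * τ ^ 2) * ‖s‖ ^ 2)) := by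
  obtain ⟨h1, h2⟩ := hX.integral_exp_norm_add_sq_le hm s hmean ha haτ
  rw [← ofReal_integral_eq_lintegral_ofReal h1
    (Filter.Eventually.of_forall fun z => (Real.exp_pos _).le), ← ENNReal.ofReal_mul (by positivity)]
  exact ENNReal.ofReal_le_ofReal h2

/-- One step of the exponential-moment recursion, for an increment driven by a fresh sample. -/
theorem lintegral_exp_norm_add_sq_le_of_indep {Ω 𝒰 : Type*} {𝒢 m : MeasurableSpace Ω}
    [MeasurableSpace 𝒰] {μ : Measure Ω} [IsProbabilityMeasure μ]
    (h𝒢 : 𝒢 ≤ m) {s : Ω → V} {U : Ω → 𝒰} {z : Ω → S} {ψ : 𝒰 → S → V} {τ a : ℝ}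
    (hs : Measurable[𝒢] s) (hU : Measurable[𝒢] U) (hz : Measurable z) (hlaw : μ.map z = P)
    (hind : Indep (MeasurableSpace.comap z inferInstance) 𝒢 μ)
    (hψ : Measurable (Function.uncurry ψ)) (hsub : ∀ u, PsiTwo P (fun y => ‖ψ u y‖) τ)
    (hmean : ∀ u v, ∫ y, inner ℝ v (ψ u y) ∂P = 0) (ha : 0 ≤ a) (haτ : 2 * a * τ ^ 2 ≤ 1) :
    ∫⁻ ω, ENNReal.ofReal (Real.exp (a * ‖s ω + ψ (U ω) (z ω)‖ ^ 2)) ∂μ ≤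
      ENNReal.ofReal (Real.exp (a * τ ^ 2)) *
        ∫⁻ ω, ENNReal.ofReal (Real.exp ((a + 8 * a ^ 2 * τ ^ 2) * ‖s ω‖ ^ 2)) ∂μ := by
  have hs' : Measurable s := hs.mono h𝒢 le_rfl
  have hU' : Measurable U := hU.mono h𝒢 le_rfl
  have hsU : Measurable (fun ω => (s ω, U ω)) := hs'.prodMk hU'
  have hI : IndepFun (fun ω => (s ω, U ω)) z μ := by
    rw [IndepFun_iff_Indep]
    refine indep_of_indep_of_le_left hind.symm ?_
    exact Measurable.comap_le (m₁ := 𝒢) (hs.prodMk hU)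
  have hmap := (indepFun_iff_map_prod_eq_prod_map_map hsU.aemeasurable hz.aemeasurable).mp hI
  rw [hlaw] at hmap
  have hΦ : Measurable (fun q : (V × 𝒰) × S =>
      ENNReal.ofReal (Real.exp (a * ‖q.1.1 + ψ q.1.2 q.2‖ ^ 2))) := by
    have : Measurable (fun q : (V × 𝒰) × S => ψ q.1.2 q.2) :=
      hψ.comp ((measurable_snd.comp measurable_fst).prodMk measurable_snd)
    fun_prop
  calc _ = ∫⁻ q, ENNReal.ofReal (Real.exp (a * ‖q.1.1 + ψ q.1.2 q.2‖ ^ 2))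
          ∂(μ.map (fun ω => ((s ω, U ω), z ω))) := (lintegral_map hΦ (hsU.prodMk hz)).symm
    _ = ∫⁻ q, ∫⁻ y, ENNReal.ofReal (Real.exp (a * ‖q.1 + ψ q.2 y‖ ^ 2)) ∂P
          ∂(μ.map (fun ω => (s ω, U ω))) := by
        rw [hmap, lintegral_prod _ hΦ.aemeasurable]
    _ ≤ ∫⁻ q, ENNReal.ofReal (Real.exp (a * τ ^ 2)) *
          ENNReal.ofReal (Real.exp ((a + 8 * a ^ 2 * τ ^ 2) * ‖q.1‖ ^ 2))
          ∂(μ.map (fun ω => (s ω, U ω))) :=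
        lintegral_mono fun q => (hsub q.2).lintegral_exp_norm_add_sq_le
          (hψ.comp measurable_prodMk_left) q.1 (hmean q.2 q.1) ha haτ
    _ = _ := by
        rw [lintegral_map (by fun_prop) hsU, lintegral_const_mul]
        fun_prop

/-- A martingale whose `n`-th increment is `ψ n (U n) (z n)`, with `z n` a fresh sample and `U n`
known beforehand. -/
theorem lintegral_exp_norm_sum_sq_le {Ω : Type*} {𝒰 : ℕ → Type*} {𝒢 : ℕ → MeasurableSpace Ω}
    {m : MeasurableSpace Ω} [∀ n, MeasurableSpace (𝒰 n)] {μ : Measure Ω} [IsProbabilityMeasure μ]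
    (h𝒢 : ∀ n, 𝒢 n ≤ m) (hmono : ∀ n, 𝒢 n ≤ 𝒢 (n + 1))
    {U : (n : ℕ) → Ω → 𝒰 n} {z : ℕ → Ω → S} {ψ : (n : ℕ) → 𝒰 n → S → V} {τ : ℝ}
    (hU : ∀ n, Measurable[𝒢 n] (U n)) (hz : ∀ n, Measurable[𝒢 (n + 1)] (z n))
    (hlaw : ∀ n, μ.map (z n) = P)
    (hind : ∀ n, Indep (MeasurableSpace.comap (z n) inferInstance) (𝒢 n) μ)
    (hψ : ∀ n, Measurable (Function.uncurry (ψ n)))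
    (hsub : ∀ n u, PsiTwo P (fun y => ‖ψ n u y‖) τ)
    (hmean : ∀ n u v, ∫ y, inner ℝ v (ψ n u y) ∂P = 0) {r : ℝ} (hr : 2 ≤ r) (n : ℕ) :
    ∀ a : ℝ, 0 ≤ a → a * (τ ^ 2 * (8 * n + r)) ≤ 1 →
    ∫⁻ ω, ENNReal.ofReal (Real.exp (a * ‖∑ i ∈ Finset.range n, ψ i (U i ω) (z i ω)‖ ^ 2)) ∂μ ≤
      ENNReal.ofReal (Real.exp (n / r)) := by
  have hS : ∀ n, Measurable[𝒢 n] (fun ω => ∑ i ∈ Finset.range n, ψ i (U i ω) (z i ω)) := by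
    intro n
    induction n with
    | zero => simp only [Finset.range_zero, Finset.sum_empty]; exact measurable_const
    | succ n ih =>
      simp only [Finset.sum_range_succ]
      exact (ih.mono (hmono n) le_rfl).add
        ((hψ n).comp (((hU n).mono (hmono n) le_rfl).prodMk (hz n)))
  induction n with
  | zero => intro a _ _; simp
  | succ n ih =>
    intro a ha h
    have hu0 : Nonempty Ω := μ.nonempty_of_neZero
    have hτ : 0 < τ := (hsub n (U n hu0.some)).pos
    have hn : (0 : ℝ) ≤ n := n.cast_nonneg
    have hb : 0 ≤ a * τ ^ 2 := by positivity
    push_cast at h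
    set y : ℝ := 8 * n + r with hy
    have hy2 : 2 ≤ y := by linarith
    have h1 : a * τ ^ 2 * (y + 8) ≤ 1 := by rw [hy]; linarith
    simp only [Finset.sum_range_succ]
    refine (lintegral_exp_norm_add_sq_le_of_indep (h𝒢 n) (hS n) (hU n)
      ((hz n).mono (h𝒢 _) le_rfl) (hlaw n) (hind n) (hψ n) (hsub n) (hmean n) ha
      (by nlinarith)).trans ?_
    -- The substitution `a ↦ a + 8 a² τ²` lowers `1/a` by at most `8 τ²`, which is why the
    -- admissible range of `a` shrinks by the term `8 n`.
    have h2 : (a + 8 * a ^ 2 * τ ^ 2) * (τ ^ 2 * y) ≤ 1 := by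
      have e : (a + 8 * a ^ 2 * τ ^ 2) * (τ ^ 2 * y) = (a * τ ^ 2) * (1 + 8 * (a * τ ^ 2)) * y := by
        ring
      rw [e]
      generalize a * τ ^ 2 = b at *
      have h3 : b ≤ 1 / (y + 8) := by rw [le_div_iff₀ (by linarith)]; exact h1
      calc b * (1 + 8 * b) * y ≤ 1 / (y + 8) * (1 + 8 * (1 / (y + 8))) * y := by gcongr
        _ ≤ 1 := by
          rw [show 1 / (y + 8) * (1 + 8 * (1 / (y + 8))) * y = (y + 16) * y / (y + 8) ^ 2 by
            field_simp; ring, div_le_one (by positivity)]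
          nlinarith
    calc _ ≤ ENNReal.ofReal (Real.exp (a * τ ^ 2)) * ENNReal.ofReal (Real.exp (n / r)) := by
          gcongr
          exact ih _ (by positivity) h2
      _ ≤ _ := by
        rw [← ENNReal.ofReal_mul (by positivity), ← Real.exp_add]
        apply ENNReal.ofReal_le_ofReal
        gcongr
        push_cast
        rw [add_div, add_comm]
        gcongr
        rw [le_div_iff₀ (by linarith)]
        nlinarith

/-- Dimension-free Azuma–Hoeffding inequality with sub-Gaussian increments. -/
theorem measure_norm_sum_sq_gt_le {Ω : Type*} {𝒰 : ℕ → Type*} {𝒢 : ℕ → MeasurableSpace Ω}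
    {m : MeasurableSpace Ω} [∀ n, MeasurableSpace (𝒰 n)] {μ : Measure Ω} [IsProbabilityMeasure μ]
    (h𝒢 : ∀ n, 𝒢 n ≤ m) (hmono : ∀ n, 𝒢 n ≤ 𝒢 (n + 1))
    {U : (n : ℕ) → Ω → 𝒰 n} {z : ℕ → Ω → S} {ψ : (n : ℕ) → 𝒰 n → S → V} {τ : ℝ} (hτ : 0 < τ)
    (hU : ∀ n, Measurable[𝒢 n] (U n)) (hz : ∀ n, Measurable[𝒢 (n + 1)] (z n))
    (hlaw : ∀ n, μ.map (z n) = P)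
    (hind : ∀ n, Indep (MeasurableSpace.comap (z n) inferInstance) (𝒢 n) μ)
    (hψ : ∀ n, Measurable (Function.uncurry (ψ n)))
    (hsub : ∀ n u, PsiTwo P (fun y => ‖ψ n u y‖) τ)
    (hmean : ∀ n u v, ∫ y, inner ℝ v (ψ n u y) ∂P = 0) {n : ℕ} (hn : 1 ≤ n) (ℓ : ℝ) :
    μ {ω | 10 * n * τ ^ 2 * ℓ < ‖∑ i ∈ Finset.range n, ψ i (U i ω) (z i ω)‖ ^ 2} ≤
      ENNReal.ofReal (Real.exp (1 / 2 - ℓ)) := by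
  have hn' : (1 : ℝ) ≤ n := by exact_mod_cast hn
  have hU' := fun i => (hU i).mono (h𝒢 i) le_rfl
  have hz' := fun i => (hz i).mono (h𝒢 (i + 1)) le_rfl
  -- With `r = 2n` the constraint becomes `a = 1/(10 n τ²)` and the moment bound `exp (n/r)` is the
  -- constant `exp (1/2)`.
  have hbound := lintegral_exp_norm_sum_sq_le h𝒢 hmono hU hz hlaw hind hψ hsub hmean
    (r := 2 * n) (by linarith) n (1 / (10 * n * τ ^ 2)) (by positivity)
    (by rw [one_div, inv_mul_le_iff₀ (by positivity)]; linarith)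
  rw [show (n : ℝ) / (2 * n) = 1 / 2 by field_simp] at hbound
  have hmeas : Measurable (fun ω => ∑ i ∈ Finset.range n, ψ i (U i ω) (z i ω)) :=
    Finset.measurable_sum _ fun i _ => (hψ i).comp ((hU' i).prodMk (hz' i))
  calc _ ≤ μ {ω | ENNReal.ofReal (Real.exp ℓ) ≤ ENNReal.ofReal (Real.exp
        (1 / (10 * n * τ ^ 2) * ‖∑ i ∈ Finset.range n, ψ i (U i ω) (z i ω)‖ ^ 2))} := by
        refine measure_mono fun ω hω => ?_
        simp only [Set.mem_ofPred_eq] at hω ⊢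
        apply ENNReal.ofReal_le_ofReal
        gcongr
        rw [one_div, le_inv_mul_iff₀ (by positivity)]
        exact hω.le
    _ ≤ ENNReal.ofReal (Real.exp (1 / 2)) / ENNReal.ofReal (Real.exp ℓ) := by
        refine (meas_ge_le_lintegral_div (by fun_prop) (by simp [Real.exp_pos])
          ENNReal.ofReal_ne_top).trans ?_
        gcongr
    _ = _ := by
        rw [← ENNReal.ofReal_div_of_pos (Real.exp_pos _), ← Real.exp_sub]

end Concentration

/-! ### Calculus of the `ψ₂` norm. -/

section PsiTwo

variable {S : Type*} [MeasurableSpace S] {P : Measure S}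

theorem SubGaussianNoise.psiTwo {V : Type*} [NormedAddCommGroup V] {X : S → V} {σ : ℝ}
    (h : SubGaussianNoise P X σ) (hσ : 0 < σ) (hm : Measurable (fun z => ‖X z‖)) :
    PsiTwo P (fun z => ‖X z‖) σ := by
  unfold SubGaussianNoise at h
  simp only [← div_pow] at h
  have hm' : Measurable fun z => Real.exp ((‖X z‖ / σ) ^ 2) := by fun_prop
  have hi : Integrable (fun z => Real.exp ((‖X z‖ / σ) ^ 2)) P := by
    refine ⟨hm'.aestronglyMeasurable, ?_⟩
    rw [hasFiniteIntegral_iff_ofReal (Filter.Eventually.of_forall fun z => (Real.exp_pos _).le)]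
    exact h.trans_lt ENNReal.ofReal_lt_top
  refine ⟨hσ, hm, hi, ?_⟩
  rwa [← ofReal_integral_eq_lintegral_ofReal hi
    (Filter.Eventually.of_forall fun z => (Real.exp_pos _).le),
    ENNReal.ofReal_le_ofReal_iff (Real.exp_pos _).le] at h

/-- Triangle inequality for the `ψ₂` norm. -/
theorem PsiTwo.of_abs_le [IsProbabilityMeasure P] {X U V : S → ℝ} {σ ρ b c : ℝ}
    (hU : PsiTwo P U σ) (hV : PsiTwo P V ρ) (hX : Measurable X) (hb : 0 ≤ b) (hc : 0 ≤ c)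
    (h : ∀ z, |X z| ≤ |U z| + c * |V z| + b) : PsiTwo P X (σ + c * ρ + b) := by
  have hσ := hU.pos
  have hρ := hV.pos
  set τ := σ + c * ρ + b with hτ
  have hτp : 0 < τ := by positivity
  set u : S → ℝ := fun z => (σ * Real.exp ((U z / σ) ^ 2) + c * ρ * Real.exp ((V z / ρ) ^ 2)
    + b * Real.exp 1) / τ with hu
  have hui : Integrable u P := (((hU.integrable.const_mul _).add (hV.integrable.const_mul _)).add
    (integrable_const _)).div_const _
  have hpt : ∀ z, Real.exp ((X z / τ) ^ 2) ≤ u z := fun z => by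
    -- Jensen twice with weights `σ/τ`, `c ρ/τ`, `b/τ`: first for the square, then for `exp` through
    -- its tangent at `m`. The constant `b` acts as a variable of normalised size `1`.
    set m := (σ * (U z / σ) ^ 2 + c * ρ * (V z / ρ) ^ 2 + b) / τ with hm
    have h1 : (X z / τ) ^ 2 ≤ m := by
      have h2 : |X z| ≤ σ * |U z / σ| + c * ρ * |V z / ρ| + b := by
        refine (h z).trans (le_of_eq ?_)
        rw [abs_div, abs_div, abs_of_pos hσ, abs_of_pos hρ]; field_simp
      rw [hm, ← sq_abs (U z / σ), ← sq_abs (V z / ρ), div_pow, div_le_div_iff₀ (by positivity) hτp,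
        ← sq_abs (X z)]
      generalize |U z / σ| = p at *
      generalize |V z / ρ| = q at *
      have h3 : |X z| ^ 2 ≤ (σ * p + c * ρ * q + b) ^ 2 := by gcongr
      have hcρ : 0 ≤ c * ρ := by positivity
      have h4 : (σ * p + c * ρ * q + b) ^ 2 ≤ (σ * p ^ 2 + c * ρ * q ^ 2 + b) * τ := by
        rw [hτ]
        nlinarith [mul_nonneg (mul_nonneg hσ.le hcρ) (sq_nonneg (p - q)),
          mul_nonneg (mul_nonneg hσ.le hb) (sq_nonneg (p - 1)),
          mul_nonneg (mul_nonneg hcρ hb) (sq_nonneg (q - 1))]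
      nlinarith
    refine (Real.exp_le_exp.mpr h1).trans ?_
    have key : ∀ y, Real.exp m * (1 + (y - m)) ≤ Real.exp y := fun y => by
      have := Real.add_one_le_exp (y - m)
      calc Real.exp m * (1 + (y - m)) ≤ Real.exp m * Real.exp (y - m) := by gcongr; linarith
        _ = Real.exp y := by rw [← Real.exp_add]; ring_nf
    have hmτ : σ * (U z / σ) ^ 2 + c * ρ * (V z / ρ) ^ 2 + b = m * τ := by
      rw [hm]; field_simp
    rw [hu, le_div_iff₀ hτp]
    have k1 := mul_le_mul_of_nonneg_left (key ((U z / σ) ^ 2)) hσ.le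
    have k2 := mul_le_mul_of_nonneg_left (key ((V z / ρ) ^ 2)) (by positivity : 0 ≤ c * ρ)
    have k3 := mul_le_mul_of_nonneg_left (key 1) hb
    calc Real.exp m * τ = σ * (Real.exp m * (1 + ((U z / σ) ^ 2 - m)))
          + c * ρ * (Real.exp m * (1 + ((V z / ρ) ^ 2 - m))) + b * (Real.exp m * (1 + (1 - m))) := by
          linear_combination Real.exp m * (m - 1) * hτ - Real.exp m * hmτ + Real.exp m * hτ * (2 - m)
      _ ≤ _ := add_le_add (add_le_add k1 k2) k3
  have hint : Integrable (fun z => Real.exp ((X z / τ) ^ 2)) P :=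
    hui.mono' (by fun_prop) (Filter.Eventually.of_forall fun z => by
      rw [Real.norm_eq_abs, Real.abs_exp]; exact hpt z)
  refine ⟨hτp, hX, hint, (integral_mono hint hui hpt).trans ?_⟩
  have hadd := (hU.integrable.const_mul σ).add (hV.integrable.const_mul (c * ρ))
  rw [hu, integral_div, integral_add (by exact hadd) (integrable_const _), integral_add (hU.integrable.const_mul _) (hV.integrable.const_mul _),
    integral_const_mul, integral_const_mul, integral_const, div_le_iff₀ hτp]
  simp only [probReal_univ, one_smul]
  have k1 := mul_le_mul_of_nonneg_left hU.le hσ.le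
  have k2 := mul_le_mul_of_nonneg_left hV.le (by positivity : 0 ≤ c * ρ)
  rw [hτ]
  linarith

end PsiTwo

/-! ### First-order estimates on convex sets. -/

section Calculus

variable {E : Type*} [NormedAddCommGroup E] [InnerProductSpace ℝ E] [CompleteSpace E]

/-- This is the mean value inequality on the segment for `φ` minus its linearisation. It yields `L`
instead of the sharp `L/2`, which is enough for the stated rates. -/
theorem abs_sub_sub_inner_gradient_le {φ : E → ℝ} {Z : Set E} {L : ℝ} (hZ : Convex ℝ Z)
    (hφ : ∀ x ∈ Z, DifferentiableAt ℝ φ x) (hL0 : 0 ≤ L)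
    (hL : ∀ x ∈ Z, ∀ y ∈ Z, ‖gradient φ x - gradient φ y‖ ≤ L * ‖x - y‖) {x y : E}
    (hx : x ∈ Z) (hy : y ∈ Z) :
    |φ y - φ x - inner ℝ (gradient φ x) (y - x)| ≤ L * ‖y - x‖ ^ 2 := by
  have hseg := hZ.segment_subset hx hy
  have := (convex_segment x y).norm_image_sub_le_of_norm_fderiv_le' (f := φ) (φ := fderiv ℝ φ x)
    (C := L * ‖y - x‖) (fun z hz => hφ z (hseg hz)) (fun z hz => ?_)
    (left_mem_segment ℝ x y) (right_mem_segment ℝ x y)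
  · rw [inner_gradient_left, ← Real.norm_eq_abs, pow_two, ← mul_assoc]
    exact this
  · rw [← toDual_gradient, ← toDual_gradient, ← map_sub, LinearIsometryEquiv.norm_map]
    refine (hL z (hseg hz) x hx).trans ?_
    gcongr
    rw [segment_eq_image'] at hz
    obtain ⟨t, ⟨ht0, ht1⟩, rfl⟩ := hz
    rw [add_sub_cancel_left, norm_smul, Real.norm_of_nonneg ht0]
    exact mul_le_of_le_one_left (norm_nonneg _) ht1

/-- Difference quotients with step `1/c` serve three purposes: the gradient inequality,
measurability of gradients, and unbiasedness. -/
theorem tendsto_inner_gradient {φ : E → ℝ} {x : E} (h : DifferentiableAt ℝ φ x) (v : E) :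
    Filter.Tendsto (fun c : ℝ => c * (φ (x + c⁻¹ • v) - φ x)) Filter.atTop
      (nhds (inner ℝ (gradient φ x) v)) := by
  rw [inner_gradient_left]
  exact h.hasFDerivAt.lim_real v

omit [CompleteSpace E] in
theorem _root_.Convex.add_inv_smul_sub_mem {Z : Set E} (hZ : Convex ℝ Z) {x y : E} (hx : x ∈ Z)
    (hy : y ∈ Z) {c : ℝ} (hc : 1 ≤ c) : x + c⁻¹ • (y - x) ∈ Z :=
  hZ.add_smul_sub_mem hx hy ⟨by positivity, inv_le_one_of_one_le₀ hc⟩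

/-- First-order characterisation of convexity. -/
theorem inner_gradient_le_of_convexOn {φ : E → ℝ} {Z : Set E} (hφ : ConvexOn ℝ Z φ) {x y : E}
    (hx : x ∈ Z) (hy : y ∈ Z) (hd : DifferentiableAt ℝ φ x) :
    inner ℝ (gradient φ x) (y - x) ≤ φ y - φ x := by
  refine le_of_tendsto (tendsto_inner_gradient hd (y - x)) ?_
  filter_upwards [Filter.eventually_ge_atTop (1 : ℝ)] with c hc
  have hc0 : 0 < c := by linarith
  have h := hφ.2 hx hy (sub_nonneg.mpr (inv_le_one_of_one_le₀ hc)) (by positivity : 0 ≤ c⁻¹) (by ring)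
  rw [show (1 - c⁻¹) • x + c⁻¹ • y = x + c⁻¹ • (y - x) by module] at h
  simp only [smul_eq_mul] at h
  calc c * (φ (x + c⁻¹ • (y - x)) - φ x) ≤ c * ((1 - c⁻¹) * φ x + c⁻¹ * φ y - φ x) := by gcongr
    _ = _ := by field_simp; ring

end Calculus

/-! ### Stochastic gradients: measurability, and unbiasedness along `Z`. -/

section Oracle

variable {d : ℕ} {S : Type*} [MeasurableSpace S]

/-- The assumptions on one level: a smooth stochastic function with sub-Gaussian gradients. -/
structure IsOracle (Z : Set (Vec d)) (P : Measure S) (F : Vec d → S → ℝ) (D L σ : ℝ) : Prop where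
  convex : Convex ℝ Z
  compact : IsCompact Z
  diam : ∀ x ∈ Z, ∀ y ∈ Z, ‖x - y‖ ≤ D
  prob : IsProbabilityMeasure P
  meas : Measurable (Function.uncurry F)
  int : ∀ x ∈ Z, Integrable (F x) P
  diff : ∀ z, ∀ x ∈ Z, DifferentiableAt ℝ (fun y => F y z) x
  diff_mean : ∀ x ∈ Z, DifferentiableAt ℝ (fun y => ∫ z, F y z ∂P) x
  L_nonneg : 0 ≤ L
  σ_pos : 0 < σ
  smooth : ∀ z, ∀ x ∈ Z, ∀ y ∈ Z,
    ‖gradient (fun u => F u z) x - gradient (fun u => F u z) y‖ ≤ L * ‖x - y‖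
  noise : ∀ x ∈ Z, SubGaussianNoise P
    (fun z => gradient (fun u => F u z) x - gradient (fun y => ∫ z, F y z ∂P) x) σ

/-- The noise of the stochastic gradient. -/
noncomputable def gradNoise (P : Measure S) (F : Vec d → S → ℝ) (x : Vec d) (z : S) : Vec d :=
  gradient (fun u => F u z) x - gradient (fun y => ∫ z, F y z ∂P) x

/-- The orthogonal projection on the directions of the affine span of `Z`. -/
noncomputable def tangentProj (Z : Set (Vec d)) : Vec d →L[ℝ] Vec d := (vectorSpan ℝ Z).starProjection

/-- The projection loses no information: differences of points of `Z` lie in its range. -/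
theorem inner_tangentProj_sub {Z : Set (Vec d)} {x y : Vec d} (hx : x ∈ Z) (hy : y ∈ Z) (v : Vec d) :
    inner ℝ (tangentProj Z v) (y - x) = inner ℝ v (y - x) := by
  rw [tangentProj, Submodule.inner_starProjection_left_eq_right,
    Submodule.starProjection_eq_self_iff.mpr]
  exact vsub_mem_vectorSpan ℝ hy hx

theorem norm_tangentProj_le (Z : Set (Vec d)) (v : Vec d) : ‖tangentProj Z v‖ ≤ ‖v‖ :=
  Submodule.norm_starProjection_apply_le _ v

theorem tangentProj_mem (Z : Set (Vec d)) (v : Vec d) : tangentProj Z v ∈ vectorSpan ℝ Z :=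
  Submodule.starProjection_apply_mem _ v

theorem inner_tangentProj_comm (Z : Set (Vec d)) (v w : Vec d) :
    inner ℝ v (tangentProj Z w) = inner ℝ (tangentProj Z v) w :=
  (Submodule.inner_starProjection_left_eq_right _ v w).symm

/-- The stochastic gradient is jointly measurable. -/
theorem measurable_gradient_of_differentiableAt {Z : Set (Vec d)} {F : Vec d → S → ℝ}
    (hF : Measurable (Function.uncurry F))
    (hd : ∀ z, ∀ x ∈ Z, DifferentiableAt ℝ (fun y => F y z) x) :
    Measurable (fun q : Z × S => gradient (fun u => F u q.2) (q.1 : Vec d)) := by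
  refine (WithLp.measurable_toLp 2 (Fin d → ℝ)).comp
    (f := fun q : Z × S => WithLp.ofLp (gradient (fun u => F u q.2) (q.1 : Vec d))) ?_
  rw [measurable_pi_iff]
  intro i
  set e : Vec d := EuclideanSpace.single i 1 with he
  -- Coordinates of the gradient are limits of difference quotients. Their points may leave `Z`,
  -- which is harmless because `F` is measurable everywhere.
  refine measurable_of_tendsto_metrizable'
    (f := fun (n : ℕ) (q : Z × S) =>
      (n : ℝ) * (F ((q.1 : Vec d) + (n : ℝ)⁻¹ • e) q.2 - F q.1 q.2)) Filter.atTop (fun n => ?_) ?_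
  · have h1 : Measurable fun q : Z × S => F ((q.1 : Vec d) + (n : ℝ)⁻¹ • e) q.2 :=
      hF.comp (by fun_prop : Measurable fun q : Z × S => ((q.1 : Vec d) + (n : ℝ)⁻¹ • e, q.2))
    have h2 : Measurable fun q : Z × S => F q.1 q.2 :=
      hF.comp (by fun_prop : Measurable fun q : Z × S => ((q.1 : Vec d), q.2))
    exact (h1.sub h2).const_mul _
  · refine tendsto_pi_nhds.mpr fun q => ?_
    have h := (tendsto_inner_gradient (hd q.2 q.1 q.1.2) e).comp
      (tendsto_natCast_atTop_atTop (R := ℝ))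
    have h2 : inner ℝ (gradient (fun u => F u q.2) (q.1 : Vec d)) e =
        gradient (fun u => F u q.2) (q.1 : Vec d) i := by
      rw [he, EuclideanSpace.inner_single_right]; simp
    rw [h2] at h
    exact h

theorem abs_integral_le_of_abs_le {P : Measure S} [IsProbabilityMeasure P] {u : S → ℝ} {C : ℝ}
    (h : ∀ z, |u z| ≤ C) : |∫ z, u z ∂P| ≤ C := by
  have := norm_integral_le_of_norm_le_const (μ := P) (f := u) (Filter.Eventually.of_forall h)
  rwa [probReal_univ, mul_one] at this

namespace IsOracle

variable {Z : Set (Vec d)} {P : Measure S} {F : Vec d → S → ℝ} {D L σ : ℝ}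

theorem measurable_gradient (h : IsOracle Z P F D L σ) {x : Vec d} (hx : x ∈ Z) :
    Measurable (fun z => gradient (fun u => F u z) x) :=
  (measurable_gradient_of_differentiableAt h.meas h.diff).comp
    (measurable_prodMk_left (x := (⟨x, hx⟩ : Z)))

theorem measurable_gradNoise (h : IsOracle Z P F D L σ) :
    Measurable (fun q : Z × S => gradNoise P F q.1 q.2) := by
  refine (measurable_gradient_of_differentiableAt h.meas h.diff).sub ?_
  have : Measurable (gradient (fun y => ∫ z, F y z ∂P)) :=
    (InnerProductSpace.toDual ℝ (Vec d)).symm.continuous.measurable.comp (measurable_fderiv ℝ _)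
  exact this.comp (measurable_subtype_coe.comp measurable_fst)

theorem measurable_mean (h : IsOracle Z P F D L σ) : Measurable (fun y => ∫ z, F y z ∂P) :=
  have := h.prob
  (h.meas.stronglyMeasurable.integral_prod_right (f := F)).measurable

theorem psiTwo_gradNoise (h : IsOracle Z P F D L σ) {x : Vec d} (hx : x ∈ Z) :
    PsiTwo P (fun z => ‖gradNoise P F x z‖) σ :=
  (h.noise x hx).psiTwo h.σ_pos ((h.measurable_gradient hx).sub_const _).norm

theorem taylor (h : IsOracle Z P F D L σ) (z : S) {x y : Vec d} (hx : x ∈ Z) (hy : y ∈ Z) :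
    |F y z - F x z - inner ℝ (gradient (fun u => F u z) x) (y - x)| ≤ L * ‖y - x‖ ^ 2 :=
  abs_sub_sub_inner_gradient_le h.convex (h.diff z) h.L_nonneg (h.smooth z) hx hy

theorem integrable_inner_gradient (h : IsOracle Z P F D L σ) {x : Vec d} (hx : x ∈ Z) (w : Vec d) :
    Integrable (fun z => inner ℝ (gradient (fun u => F u z) x) w) P := by
  have := h.prob
  have hi : Integrable (fun z => gradNoise P F x z) P := by
    refine (integrable_norm_iff ?_).mp (h.psiTwo_gradNoise hx).integrable_self
    exact ((h.measurable_gradient hx).sub_const _).aestronglyMeasurable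
  have hg : Integrable (fun z => gradient (fun u => F u z) x) P := by
    refine (hi.add (integrable_const (gradient (fun y => ∫ z, F y z ∂P) x))).congr
      (Filter.Eventually.of_forall fun z => ?_)
    simp only [Pi.add_apply, gradNoise, sub_add_cancel]
  exact hg.inner_const w

theorem abs_mean_sub_le (h : IsOracle Z P F D L σ) {x y : Vec d} (hx : x ∈ Z) (hy : y ∈ Z) :
    |(∫ z, F y z ∂P) - (∫ z, F x z ∂P) - ∫ z, inner ℝ (gradient (fun u => F u z) x) (y - x) ∂P|
      ≤ L * ‖y - x‖ ^ 2 := by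
  have := h.prob
  have hi := h.integrable_inner_gradient hx (y - x)
  rw [← integral_sub (h.int y hy) (h.int x hx), ← integral_sub (by exact (h.int y hy).sub (h.int x hx)) hi]
  exact abs_integral_le_of_abs_le fun z => h.taylor z hx hy

/-- The Taylor remainder is uniform in the sample, so it survives integration. Dividing by the step
and letting it tend to zero identifies the mean directional derivative with that of the mean. -/
theorem integral_inner_gradient_sub (h : IsOracle Z P F D L σ) {x y : Vec d} (hx : x ∈ Z)
    (hy : y ∈ Z) :
    ∫ z, inner ℝ (gradient (fun u => F u z) x) (y - x) ∂P =
      inner ℝ (gradient (fun y => ∫ z, F y z ∂P) x) (y - x) := by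
  set I := ∫ z, inner ℝ (gradient (fun u => F u z) x) (y - x) ∂P with hI
  refine tendsto_nhds_unique ?_ (tendsto_inner_gradient (h.diff_mean x hx) (y - x))
  have h0 : Filter.Tendsto (fun c : ℝ => L * ‖y - x‖ ^ 2 * c⁻¹) Filter.atTop (nhds 0) := by
    simpa using tendsto_inv_atTop_zero.const_mul (L * ‖y - x‖ ^ 2)
  rw [tendsto_iff_dist_tendsto_zero]
  refine squeeze_zero' (Filter.Eventually.of_forall fun _ => dist_nonneg) ?_ h0
  filter_upwards [Filter.eventually_ge_atTop (1 : ℝ)] with c hc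
  have hc0 : 0 < c := by linarith
  have hb := h.abs_mean_sub_le hx (h.convex.add_inv_smul_sub_mem hx hy hc)
  simp only [add_sub_cancel_left, inner_smul_right, integral_const_mul, norm_smul, mul_pow,
    Real.norm_of_nonneg (inv_nonneg.mpr hc0.le)] at hb
  rw [← hI] at hb
  rw [Real.dist_eq]
  calc _ = c * |(∫ z, F (x + c⁻¹ • (y - x)) z ∂P) - (∫ z, F x z ∂P) - c⁻¹ * I| := by
        rw [← abs_of_pos hc0, ← abs_mul, abs_of_pos hc0]
        congr 1
        field_simp
    _ ≤ c * (L * (c⁻¹ ^ 2 * ‖y - x‖ ^ 2)) := by gcongr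
    _ = _ := by field_simp

/-- The mean is smooth along the feasible directions. -/
theorem mean_taylor (h : IsOracle Z P F D L σ) {x y : Vec d} (hx : x ∈ Z) (hy : y ∈ Z) :
    |(∫ z, F y z ∂P) - (∫ z, F x z ∂P) - inner ℝ (gradient (fun y => ∫ z, F y z ∂P) x) (y - x)|
      ≤ L * ‖y - x‖ ^ 2 := by
  rw [← h.integral_inner_gradient_sub hx hy]
  exact h.abs_mean_sub_le hx hy

/-- The stochastic gradient is unbiased along the feasible directions. -/
theorem integral_inner_gradient (h : IsOracle Z P F D L σ) {x w : Vec d} (hx : x ∈ Z)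
    (hw : w ∈ vectorSpan ℝ Z) :
    ∫ z, inner ℝ (gradient (fun u => F u z) x) w ∂P =
      inner ℝ (gradient (fun y => ∫ z, F y z ∂P) x) w := by
  induction hw using Submodule.span_induction with
  | mem w hw =>
    obtain ⟨y, hy, y', hy', rfl⟩ := Set.mem_vsub.mp hw
    have e : y -ᵥ y' = (y - x) - (y' - x) := by rw [vsub_eq_sub]; abel
    simp only [e, inner_sub_right _ (y - x)]
    rw [integral_sub (h.integrable_inner_gradient hx _) (h.integrable_inner_gradient hx _),
      h.integral_inner_gradient_sub hx hy, h.integral_inner_gradient_sub hx hy']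
  | zero => simp
  | add u v _ _ hu hv =>
    simp only [inner_add_right]
    rw [integral_add (h.integrable_inner_gradient hx _) (h.integrable_inner_gradient hx _), hu, hv]
  | smul c u _ hu => simp only [inner_smul_right, integral_const_mul, hu]

theorem integrable_inner_gradNoise (h : IsOracle Z P F D L σ) {x : Vec d} (hx : x ∈ Z) (w : Vec d) :
    Integrable (fun z => inner ℝ w (gradNoise P F x z)) P := by
  have := h.prob
  simp only [gradNoise, inner_sub_right]
  simp only [real_inner_comm _ w]
  exact (h.integrable_inner_gradient hx w).sub (integrable_const _)

theorem integral_inner_gradNoise (h : IsOracle Z P F D L σ) {x : Vec d} (hx : x ∈ Z) (v : Vec d) :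
    ∫ z, inner ℝ v (tangentProj Z (gradNoise P F x z)) ∂P = 0 := by
  have := h.prob
  simp only [inner_tangentProj_comm, gradNoise]
  simp only [inner_sub_right]
  simp only [real_inner_comm _ (tangentProj Z v)]
  rw [integral_sub (h.integrable_inner_gradient hx _) (integrable_const _),
    h.integral_inner_gradient hx (tangentProj_mem Z v)]
  simp

/-- Testing with the projected difference `w` itself turns `‖w‖²` into the expectation of a pairing
of stochastic gradients, where the samplewise Lipschitz bound applies. Normal components are not
controlled. -/
theorem norm_tangentProj_mean_sub_le (h : IsOracle Z P F D L σ) {x y : Vec d} (hx : x ∈ Z)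
    (hy : y ∈ Z) :
    ‖tangentProj Z (gradient (fun y => ∫ z, F y z ∂P) x - gradient (fun y => ∫ z, F y z ∂P) y)‖
      ≤ L * ‖x - y‖ := by
  have := h.prob
  set v := gradient (fun y => ∫ z, F y z ∂P) x - gradient (fun y => ∫ z, F y z ∂P) y with hv
  set w := tangentProj Z v with hw
  have hwm : w ∈ vectorSpan ℝ Z := tangentProj_mem Z v
  have h1 : ‖w‖ * ‖w‖ = ∫ z, inner ℝ (gradient (fun u => F u z) x - gradient (fun u => F u z) y) w
      ∂P := by
    simp only [inner_sub_left]
    rw [integral_sub (h.integrable_inner_gradient hx _) (h.integrable_inner_gradient hy _),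
      h.integral_inner_gradient hx hwm, h.integral_inner_gradient hy hwm, ← inner_sub_left, ← hv,
      ← real_inner_self_eq_norm_mul_norm]
    nth_rw 1 [hw]
    rw [← inner_tangentProj_comm, tangentProj, Submodule.starProjection_eq_self_iff.mpr hwm]
  have h2 : ‖w‖ * ‖w‖ ≤ ‖w‖ * (L * ‖x - y‖) := by
    rw [h1]
    refine (le_abs_self _).trans (abs_integral_le_of_abs_le fun z => ?_)
    rw [mul_comm]
    exact (abs_real_inner_le_norm _ _).trans (by gcongr; exact h.smooth z x hx y hy)
  rcases (norm_nonneg w).eq_or_lt with h0 | h0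
  · rw [← h0]; have := h.L_nonneg; positivity
  · exact le_of_mul_le_mul_left h2 h0

theorem norm_tangentProj_gradNoise_sub_le (h : IsOracle Z P F D L σ) (z : S) {x y : Vec d}
    (hx : x ∈ Z) (hy : y ∈ Z) :
    ‖tangentProj Z (gradNoise P F x z) - tangentProj Z (gradNoise P F y z)‖ ≤ 2 * L * ‖x - y‖ := by
  have e : tangentProj Z (gradNoise P F x z) - tangentProj Z (gradNoise P F y z) =
      tangentProj Z (gradient (fun u => F u z) x - gradient (fun u => F u z) y) -
      tangentProj Z (gradient (fun y => ∫ z, F y z ∂P) x - gradient (fun y => ∫ z, F y z ∂P) y) := by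
    simp only [gradNoise, map_sub]; abel
  rw [e]
  refine (norm_sub_le _ _).trans ?_
  have h1 := (norm_tangentProj_le Z _).trans (h.smooth z x hx y hy)
  have h2 := h.norm_tangentProj_mean_sub_le hx hy
  linarith

/-- Subtracting the Taylor expansions of sample and mean at `x` leaves the gradient noise as the
linear term. This replaces a Lipschitz bound for the sample values, which is not assumed. -/
theorem abs_noise_sub_le (h : IsOracle Z P F D L σ) (z : S) {x y : Vec d} (hx : x ∈ Z)
    (hy : y ∈ Z) :
    |(F x z - ∫ z, F x z ∂P) - (F y z - ∫ z, F y z ∂P)| ≤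
      ‖x - y‖ * (‖gradNoise P F x z‖ + 2 * L * ‖x - y‖) := by
  have h1 := abs_le.mp (h.taylor z hx hy)
  have h2 := abs_le.mp (h.mean_taylor hx hy)
  have h3 := abs_le.mp (abs_real_inner_le_norm (gradNoise P F x z) (y - x))
  rw [gradNoise, inner_sub_left, norm_sub_rev y x] at h3
  rw [norm_sub_rev y x] at h1 h2
  change _ ≤ ‖x - y‖ * (‖gradient (fun u => F u z) x - gradient (fun y => ∫ z, F y z ∂P) x‖ + _)
  rw [abs_le]
  constructor <;> nlinarith

end IsOracle

end Oracle

/-! ### STORM errors as martingales. -/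

section Storm

/-- The increments of the rescaled STORM error. -/
def stormIncr {X S V : Type*} [AddCommGroup V] [Module ℝ V] (N : X → S → V) (i : ℕ) (x y : X)
    (z : S) : V :=
  N x z + (i : ℝ) • (N x z - N y z)

/-- Here `1 - α_{t+1} = (t+1)/(t+2)`, so multiplication by `t+2` leaves the previous error with
factor `t+1` and the sum telescopes. At `i = 0` the truncated index `i - 1` carries coefficient
zero. -/
theorem smul_storm_sub_eq_sum {X S V : Type*} [AddCommGroup V] [Module ℝ V] (h : X → S → V)
    (H : X → V) (x : ℕ → X) (z : ℕ → S) (t : ℕ) :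
    ((t : ℝ) + 1) • (storm (fun t : ℕ => 1 / ((t : ℝ) + 1)) h x z t - H (x t)) =
      ∑ i ∈ Finset.range (t + 1), stormIncr (fun x z => h x z - H x) i (x i) (x (i - 1)) (z i) := by
  induction t with
  | zero => simp [storm, stormIncr]
  | succ t ih =>
    rw [Finset.sum_range_succ, ← ih]
    have h0 : (t : ℝ) + 1 + 1 ≠ 0 := by positivity
    simp only [storm, stormIncr, Nat.add_sub_cancel, Nat.cast_add, Nat.cast_one]
    match_scalars <;> field_simp <;> ring

theorem storm_congr {X S V : Type*} [AddCommGroup V] [Module ℝ V] (a : ℕ → ℝ) (h : X → S → V)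
    {x y : ℕ → X} (z : ℕ → S) {t : ℕ} (hxy : ∀ i ≤ t, x i = y i) :
    storm a h x z t = storm a h y z t := by
  induction t with
  | zero => simp [storm, hxy 0 le_rfl]
  | succ t ih =>
    simp only [storm, ih fun i hi => hxy i (hi.trans t.le_succ), hxy _ le_rfl, hxy t t.le_succ]

theorem iterate_congr {d : ℕ} (γ : ℕ → ℝ) (x₀ : Vec d) {s s' : ℕ → Vec d} {t : ℕ}
    (h : ∀ i < t, s i = s' i) : iterate γ x₀ s t = iterate γ x₀ s' t := by
  induction t with
  | zero => rfl
  | succ t ih =>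
    simp only [iterate, ih fun i hi => h i (hi.trans t.lt_succ_self), h t t.lt_succ_self]

theorem iterate_mem {d : ℕ} {Z : Set (Vec d)} (hZ : Convex ℝ Z) {γ : ℕ → ℝ}
    (hγ : ∀ t, 0 ≤ γ t ∧ γ t ≤ 1) {x₀ : Vec d} (hx₀ : x₀ ∈ Z) {s : ℕ → Vec d} {t : ℕ}
    (hs : ∀ i < t, s i ∈ Z) : iterate γ x₀ s t ∈ Z := by
  induction t with
  | zero => exact hx₀
  | succ t ih =>
    exact hZ (ih fun i hi => hs i (hi.trans t.lt_succ_self)) (hs t t.lt_succ_self)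
      (sub_nonneg.mpr (hγ _).2) (hγ _).1 (by ring)

variable {d : ℕ} {S V : Type*} [MeasurableSpace S] {P : Measure S} [IsProbabilityMeasure P]
  [NormedAddCommGroup V] [InnerProductSpace ℝ V] [MeasurableSpace V]
  [BorelSpace V] [SecondCountableTopology V]

/-- Possible values of two consecutive iterates. -/
abbrev StepPairs (Z : Set (Vec d)) (D : ℝ) (n : ℕ) : Type :=
  {q : Vec d × Vec d // q.1 ∈ Z ∧ q.2 ∈ Z ∧ (n : ℝ) * ‖q.1 - q.2‖ ≤ D}

theorem measure_norm_sum_stormIncr_gt_le {Ω : Type*} {m : MeasurableSpace Ω} {μ : Measure Ω}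
    [IsProbabilityMeasure μ] {ℱ : Filtration ℕ m} {x₀ : Vec d} {x : ℕ → Ω → Vec d}
    {z : ℕ → Ω → S} {N : Vec d → S → V} {Z : Set (Vec d)} {D τ : ℝ} (hτ : 0 < τ)
    (hx0 : ∀ ω, x 0 ω = x₀) (hx : ∀ n, Measurable[ℱ n] (x (n + 1))) (hxZ : ∀ n ω, x n ω ∈ Z)
    (hxD : ∀ (n : ℕ) ω, (n : ℝ) * ‖x n ω - x (n - 1) ω‖ ≤ D)
    (hz : ∀ n, Measurable[ℱ n] (z n)) (hlaw : ∀ n, μ.map (z n) = P)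
    (hind : ∀ n, Indep (MeasurableSpace.comap (z (n + 1)) inferInstance) (ℱ n) μ)
    (hN : Measurable (fun q : Z × S => N q.1 q.2))
    (hsub : ∀ (n : ℕ), ∀ u ∈ Z, ∀ v ∈ Z, (n : ℝ) * ‖u - v‖ ≤ D →
      PsiTwo P (fun y => ‖stormIncr N n u v y‖) τ)
    (hint : ∀ u ∈ Z, ∀ v, Integrable (fun y => (inner ℝ v (N u y) : ℝ)) P)
    (hmean : ∀ u ∈ Z, ∀ v, ∫ y, inner ℝ v (N u y) ∂P = 0) (t : ℕ) (ℓ : ℝ) :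
    μ {ω | 10 * ((t : ℝ) + 1) * τ ^ 2 * ℓ <
        ‖∑ i ∈ Finset.range (t + 1), stormIncr N i (x i ω) (x (i - 1) ω) (z i ω)‖ ^ 2} ≤
      ENNReal.ofReal (Real.exp (1 / 2 - ℓ)) := by
  -- The filtration is delayed by one, with a trivial start: `x n` is known before the sample `z n`
  -- is drawn, and the first sample needs no independence assumption.
  let 𝒢 : ℕ → MeasurableSpace Ω := fun n => Nat.casesOn n ⊥ fun n => ℱ n
  have hmono : ∀ n, 𝒢 n ≤ 𝒢 (n + 1) := fun n => by
    cases n with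
    | zero => exact bot_le
    | succ n => exact ℱ.mono n.le_succ
  have hx𝒢 : ∀ n, Measurable[𝒢 n] (x n) := fun n => by
    cases n with
    | zero => rw [show x 0 = fun _ => x₀ from funext hx0]; exact measurable_const
    | succ n => exact hx n
  have hx𝒢' : ∀ n, Measurable[𝒢 n] (x (n - 1)) := fun n => by
    cases n with
    | zero => exact hx𝒢 0
    | succ n => exact (hx𝒢 n).mono (hmono n) le_rfl
  -- Restricting the parameter to admissible pairs makes the `ψ₂` bound valid for every value of the
  -- parameter, as the Azuma inequality demands.
  let U : (n : ℕ) → Ω → StepPairs Z D n := fun n ω => ⟨(x n ω, x (n - 1) ω), hxZ n ω, hxZ _ ω, hxD n ω⟩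
  let ψ : (n : ℕ) → StepPairs Z D n → S → V := fun n u => stormIncr N n u.1.1 u.1.2
  have key := measure_norm_sum_sq_gt_le (𝒢 := 𝒢) (μ := μ) (P := P) (U := U) (z := z) (ψ := ψ)
    (fun n => by
      cases n with
      | zero => exact bot_le
      | succ n => exact ℱ.le n) hmono hτ
    (fun n => Measurable.subtype_mk ((hx𝒢 n).prodMk (hx𝒢' n))) hz hlaw
    (fun n => by
      cases n with
      | zero => exact indep_bot_right _
      | succ n => exact hind n)
    (fun n => by
      have h1 : Measurable fun q : StepPairs Z D n × S => N q.1.1.1 q.2 := hN.comp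
        (g := fun q : Z × S => N q.1 q.2) (f := fun q : StepPairs Z D n × S => (⟨q.1.1.1, q.1.2.1⟩, q.2))
        ((Measurable.subtype_mk (by fun_prop)).prodMk measurable_snd)
      have h2 : Measurable fun q : StepPairs Z D n × S => N q.1.1.2 q.2 := hN.comp
        (g := fun q : Z × S => N q.1 q.2) (f := fun q : StepPairs Z D n × S => (⟨q.1.1.2, q.1.2.2.1⟩, q.2))
        ((Measurable.subtype_mk (by fun_prop)).prodMk measurable_snd)
      exact h1.add ((h1.sub h2).const_smul (n : ℝ)))
    (fun n u => hsub n _ u.2.1 _ u.2.2.1 u.2.2.2)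
    (fun n u v => by
      have i1 := hint _ u.2.1 v
      have i2 := hint _ u.2.2.1 v
      simp only [ψ, stormIncr, inner_add_right, inner_smul_right, inner_sub_right v]
      rw [integral_add i1 (by exact (i1.sub i2).const_mul _), integral_const_mul, integral_sub i1 i2,
        hmean _ u.2.1, hmean _ u.2.2.1]
      simp)
    (n := t + 1) (by omega) ℓ
  push_cast at key
  exact key

end Storm

/-! ### Error bounds for one level. -/

section SingleLevel

variable {d : ℕ} {S : Type*} [MeasurableSpace S] {P : Measure S} {Z : Set (Vec d)}
  {F : Vec d → S → ℝ} {D L σ : ℝ}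

/-- The factor `n` of the increment meets a step of length at most `D/n`, so the bound is
independent of `n`. -/
theorem IsOracle.psiTwo_stormIncr_gradNoise (h : IsOracle Z P F D L σ) (n : ℕ) {u v : Vec d}
    (hu : u ∈ Z) (hv : v ∈ Z) (huv : (n : ℝ) * ‖u - v‖ ≤ D) :
    PsiTwo P (fun y => ‖stormIncr (fun x z => tangentProj Z (gradNoise P F x z)) n u v y‖)
      (σ + 2 * L * D) := by
  have := h.prob
  have hU := h.psiTwo_gradNoise hu
  have hD : 0 ≤ D := (norm_nonneg _).trans (h.diam u hu v hv)
  have hm : ∀ x ∈ Z, Measurable fun z => tangentProj Z (gradNoise P F x z) := fun x hx =>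
    (tangentProj Z).continuous.measurable.comp ((h.measurable_gradient hx).sub_const _)
  have := h.L_nonneg
  -- Only one random term is present: with `c = 0` the second argument `hU` is a dummy.
  have key := hU.of_abs_le (X := fun y =>
    ‖stormIncr (fun x z => tangentProj Z (gradNoise P F x z)) n u v y‖) (b := 2 * L * D) (c := 0) hU
    (((hm u hu).add (((hm u hu).sub (hm v hv)).const_smul (n : ℝ))).norm) (by positivity) le_rfl
    (fun z => by
      rw [abs_norm, abs_norm, stormIncr, zero_mul, add_zero]
      refine (norm_add_le _ _).trans (add_le_add (norm_tangentProj_le Z _) ?_)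
      rw [norm_smul, Real.norm_of_nonneg n.cast_nonneg]
      have := h.norm_tangentProj_gradNoise_sub_le z hu hv
      calc (n : ℝ) * _ ≤ n * (2 * L * ‖u - v‖) := by gcongr
        _ = 2 * L * (n * ‖u - v‖) := by ring
        _ ≤ _ := by gcongr)
  simpa using key

/-- The correction is `n` times a difference of value noises, hence at most `D` times the gradient
noise plus a constant; this is the origin of `D * σ`. -/
theorem IsOracle.psiTwo_stormIncr_noise (h : IsOracle Z P F D L σ) {ρ : ℝ} (hρ : 0 < ρ)
    (hF : ∀ x ∈ Z, SubGaussianNoise P (fun z => F x z - ∫ z, F x z ∂P) ρ) (n : ℕ) {u v : Vec d}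
    (hu : u ∈ Z) (hv : v ∈ Z) (huv : (n : ℝ) * ‖u - v‖ ≤ D) :
    PsiTwo P (fun y => ‖stormIncr (fun x z => F x z - ∫ z, F x z ∂P) n u v y‖)
      (ρ + D * σ + 2 * L * D ^ 2) := by
  have := h.prob
  have hD : 0 ≤ D := (norm_nonneg _).trans (h.diam u hu v hv)
  have hm : ∀ x, Measurable fun z => F x z - ∫ z, F x z ∂P := fun x =>
    (h.meas.comp measurable_prodMk_left).sub_const _
  have hU := (hF u hu).psiTwo hρ (hm u).norm
  have := h.L_nonneg
  refine hU.of_abs_le (h.psiTwo_gradNoise hu)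
    (((hm u).add (((hm u).sub (hm v)).const_smul (n : ℝ))).norm) (by positivity) hD (fun z => ?_)
  rw [abs_norm, abs_norm, abs_norm, stormIncr, add_assoc]
  refine (norm_add_le _ _).trans (add_le_add le_rfl ?_)
  rw [norm_smul, Real.norm_of_nonneg n.cast_nonneg, Real.norm_eq_abs]
  have h1 := h.abs_noise_sub_le z hu hv
  have h2 := h.diam u hu v hv
  calc (n : ℝ) * _ ≤ n * (‖u - v‖ * (‖gradNoise P F u z‖ + 2 * L * ‖u - v‖)) := by gcongr
    _ = (n * ‖u - v‖) * (‖gradNoise P F u z‖ + 2 * L * ‖u - v‖) := by ring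
    _ ≤ D * (‖gradNoise P F u z‖ + 2 * L * D) := by gcongr
    _ = _ := by ring

theorem norm_le_of_norm_smul_sq_le {V : Type*} [NormedAddCommGroup V] [NormedSpace ℝ V] {e : V}
    {τ ℓ : ℝ} (hτ : 0 < τ) {t : ℕ}
    (h : ‖((t : ℝ) + 1) • e‖ ^ 2 ≤ 10 * ((t : ℝ) + 1) * τ ^ 2 * ℓ) :
    ‖e‖ ≤ τ * √(10 * ℓ / ((t : ℝ) + 1)) := by
  have ht : (0 : ℝ) < (t : ℝ) + 1 := by positivity
  rw [norm_smul, Real.norm_of_nonneg ht.le, mul_pow] at h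
  have h1 : (‖e‖ / τ) ^ 2 ≤ 10 * ℓ / ((t : ℝ) + 1) := by
    rw [div_pow, div_le_div_iff₀ (by positivity) ht]
    nlinarith
  have := Real.le_sqrt_of_sq_le h1
  rwa [div_le_iff₀ hτ, mul_comm] at this

variable {Ω : Type*} {m : MeasurableSpace Ω} {μ : Measure Ω}
    [IsProbabilityMeasure μ] {ℱ : Filtration ℕ m} {x₀ : Vec d} {x : ℕ → Ω → Vec d}
    {z : ℕ → Ω → S}

theorem IsOracle.measure_grad_error_gt_le (h : IsOracle Z P F D L σ)
    (hx0 : ∀ ω, x 0 ω = x₀) (hx : ∀ n, Measurable[ℱ n] (x (n + 1))) (hxZ : ∀ n ω, x n ω ∈ Z)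
    (hxD : ∀ (n : ℕ) ω, (n : ℝ) * ‖x n ω - x (n - 1) ω‖ ≤ D)
    (hz : ∀ n, Measurable[ℱ n] (z n)) (hlaw : ∀ n, μ.map (z n) = P)
    (hind : ∀ n, Indep (MeasurableSpace.comap (z (n + 1)) inferInstance) (ℱ n) μ) (t : ℕ) (ℓ : ℝ) :
    μ {ω | (σ + 2 * L * D) * √(10 * ℓ / ((t : ℝ) + 1)) <
        ‖tangentProj Z (storm (fun t : ℕ => 1 / ((t : ℝ) + 1))
          (fun x z => gradient (fun u => F u z) x) (fun i => x i ω) (fun i => z i ω) t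
            - gradient (fun y => ∫ z, F y z ∂P) (x t ω))‖} ≤
      ENNReal.ofReal (Real.exp (1 / 2 - ℓ)) := by
  have := h.prob
  have hω : Nonempty Ω := μ.nonempty_of_neZero
  have hD : 0 ≤ D := (norm_nonneg _).trans (h.diam _ (hxZ 0 hω.some) _ (hxZ 0 hω.some))
  have hL := h.L_nonneg
  have hσ := h.σ_pos
  have hτ : 0 < σ + 2 * L * D := by positivity
  refine (measure_mono fun ω hω => ?_).trans (measure_norm_sum_stormIncr_gt_le (P := P)
    (N := fun x z => tangentProj Z (gradNoise P F x z)) hτ hx0 hx hxZ hxD hz hlaw hind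
    ((tangentProj Z).continuous.measurable.comp h.measurable_gradNoise)
    (fun n u hu v hv huv => h.psiTwo_stormIncr_gradNoise n hu hv huv)
    (fun u hu v => by
      simp only [inner_tangentProj_comm]; exact h.integrable_inner_gradNoise hu _)
    (fun u hu v => h.integral_inner_gradNoise hu v) t ℓ)
  simp only [Set.mem_ofPred_eq] at hω ⊢
  contrapose! hω
  apply norm_le_of_norm_smul_sq_le hτ
  rw [← map_smul, smul_storm_sub_eq_sum (fun x z => gradient (fun u => F u z) x)
    (fun x => gradient (fun y => ∫ z, F y z ∂P) x), map_sum]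
  simpa only [stormIncr, gradNoise, map_add, map_smul, map_sub] using hω

theorem IsOracle.measure_value_error_gt_le (h : IsOracle Z P F D L σ) {ρ : ℝ} (hρ : 0 < ρ)
    (hF : ∀ x ∈ Z, SubGaussianNoise P (fun z => F x z - ∫ z, F x z ∂P) ρ)
    (hx0 : ∀ ω, x 0 ω = x₀) (hx : ∀ n, Measurable[ℱ n] (x (n + 1))) (hxZ : ∀ n ω, x n ω ∈ Z)
    (hxD : ∀ (n : ℕ) ω, (n : ℝ) * ‖x n ω - x (n - 1) ω‖ ≤ D)
    (hz : ∀ n, Measurable[ℱ n] (z n)) (hlaw : ∀ n, μ.map (z n) = P)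
    (hind : ∀ n, Indep (MeasurableSpace.comap (z (n + 1)) inferInstance) (ℱ n) μ) (t : ℕ) (ℓ : ℝ) :
    μ {ω | (ρ + D * σ + 2 * L * D ^ 2) * √(10 * ℓ / ((t : ℝ) + 1)) <
        |storm (fun t : ℕ => 1 / ((t : ℝ) + 1)) F (fun i => x i ω) (fun i => z i ω) t
            - ∫ z, F (x t ω) z ∂P|} ≤
      ENNReal.ofReal (Real.exp (1 / 2 - ℓ)) := by
  have := h.prob
  have hω : Nonempty Ω := μ.nonempty_of_neZero
  have hD : 0 ≤ D := (norm_nonneg _).trans (h.diam _ (hxZ 0 hω.some) _ (hxZ 0 hω.some))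
  have hL := h.L_nonneg
  have hσ := h.σ_pos
  have hτ : 0 < ρ + D * σ + 2 * L * D ^ 2 := by positivity
  have hint : ∀ u ∈ Z, Integrable (fun y => F u y - ∫ z, F u z ∂P) P := fun u hu =>
    (h.int u hu).sub (integrable_const _)
  refine (measure_mono fun ω hω => ?_).trans (measure_norm_sum_stormIncr_gt_le (P := P)
    (N := fun x z => F x z - ∫ z, F x z ∂P) hτ hx0 hx hxZ hxD hz hlaw hind
    ((h.meas.comp (f := fun q : Z × S => ((q.1 : Vec d), q.2)) (by fun_prop)).sub
      (h.measurable_mean.comp (measurable_subtype_coe.comp measurable_fst)))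
    (fun n u hu v hv huv => h.psiTwo_stormIncr_noise hρ hF n hu hv huv)
    (fun u hu v => by
      simp only [RCLike.inner_apply, conj_trivial]
      exact (hint u hu).mul_const v)
    (fun u hu v => by
      simp only [RCLike.inner_apply, conj_trivial]
      rw [integral_mul_const, integral_sub (h.int u hu) (integrable_const _)]
      simp) t ℓ)
  simp only [Set.mem_ofPred_eq] at hω ⊢
  contrapose! hω
  rw [← Real.norm_eq_abs]
  apply norm_le_of_norm_smul_sq_le hτ
  rw [smul_storm_sub_eq_sum F (fun x => ∫ z, F x z ∂P)]
  exact hω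

end SingleLevel

/-! ### Elementary sums and the recursion. -/

section Reals

/-- The `-1` is needed: in `rate_of_recursion` it pays for the `1/2` in the harmonic sum, through `C
/ 2 ≤ b`. -/
theorem sum_inv_sqrt_le {n : ℕ} (hn : 1 ≤ n) :
    ∑ i ∈ Finset.range n, 1 / √((i : ℝ) + 1) ≤ 2 * √n - 1 := by
  induction n, hn using Nat.le_induction with
  | base => norm_num
  | succ n hn ih =>
    rw [Finset.sum_range_succ]
    have h1 : 0 < √((n : ℝ) + 1) := by positivity
    have h2 : 1 / √((n : ℝ) + 1) ≤ 2 * √((n : ℝ) + 1) - 2 * √n := by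
      rw [div_le_iff₀ h1]
      have h3 := Real.mul_self_sqrt (by positivity : 0 ≤ (n : ℝ) + 1)
      have h4 := Real.mul_self_sqrt (by positivity : 0 ≤ (n : ℝ))
      nlinarith [sq_nonneg (√((n : ℝ) + 1) - √n)]
    push_cast
    linarith

theorem sum_inv_add_two_le {n : ℕ} (hn : 1 ≤ n) :
    ∑ i ∈ Finset.range n, 1 / ((i : ℝ) + 2) ≤ Real.log n + 1 / 2 := by
  induction n, hn using Nat.le_induction with
  | base => norm_num
  | succ n hn ih =>
    rw [Finset.sum_range_succ]
    have hn' : (0 : ℝ) < n := by exact_mod_cast hn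
    have h1 := Real.one_sub_inv_le_log_of_pos (by positivity : 0 < ((n : ℝ) + 1) / n)
    rw [Real.log_div (by positivity) (by positivity), inv_div] at h1
    have h2 : 1 / ((n : ℝ) + 2) ≤ 1 - n / ((n : ℝ) + 1) := by
      rw [one_sub_div (by positivity), add_sub_cancel_left]
      gcongr; norm_num
    push_cast
    linarith

/-- The rate of a Frank–Wolfe type recursion with step sizes `1 / (i + 2)`. -/
theorem rate_of_recursion {u : ℕ → ℝ} {b C : ℝ} {t : ℕ} (ht : 1 ≤ t) (hC : 0 ≤ C) (hb : C / 2 ≤ b)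
    (h : ∀ i < t, u (i + 1) ≤ (1 - 1 / ((i : ℝ) + 2)) * u i
      + 1 / ((i : ℝ) + 2) * (b / √((i : ℝ) + 1)) + C * (1 / ((i : ℝ) + 2)) ^ 2) :
    u t ≤ 2 * b / √((t : ℝ) + 1) + (u 0 + C * Real.log t) / ((t : ℝ) + 1) := by
  -- The contraction factor is `(i+1)/(i+2)`, so `(n + 1) u n` telescopes.
  have key : ∀ n ≤ t, ((n : ℝ) + 1) * u n ≤
      u 0 + ∑ i ∈ Finset.range n, (b * (1 / √((i : ℝ) + 1)) + C * (1 / ((i : ℝ) + 2))) := by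
    intro n
    induction n with
    | zero => intro _; simp
    | succ n ih =>
      intro hn
      have h1 := ih (by omega)
      have h2 := mul_le_mul_of_nonneg_left (h n (by omega)) (by positivity : 0 ≤ (n : ℝ) + 2)
      rw [Finset.sum_range_succ]
      have e : ((n : ℝ) + 2) * ((1 - 1 / ((n : ℝ) + 2)) * u n
          + 1 / ((n : ℝ) + 2) * (b / √((n : ℝ) + 1)) + C * (1 / ((n : ℝ) + 2)) ^ 2) =
          ((n : ℝ) + 1) * u n + (b * (1 / √((n : ℝ) + 1)) + C * (1 / ((n : ℝ) + 2))) := by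
        have : √((n : ℝ) + 1) ≠ 0 := by positivity
        field_simp
        ring
      rw [e] at h2
      push_cast
      linarith
  have h1 := key t le_rfl
  rw [Finset.sum_add_distrib, ← Finset.mul_sum, ← Finset.mul_sum] at h1
  have hb0 : 0 ≤ b := le_trans (by positivity) hb
  have h2 := mul_le_mul_of_nonneg_left (sum_inv_sqrt_le ht) hb0
  have h3 := mul_le_mul_of_nonneg_left (sum_inv_add_two_le ht) hC
  have h4 : √(t : ℝ) ≤ √((t : ℝ) + 1) := Real.sqrt_le_sqrt (by linarith)
  have h5 := mul_le_mul_of_nonneg_left h4 hb0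
  have h6 : ((t : ℝ) + 1) * u t ≤ 2 * b * √((t : ℝ) + 1) + (u 0 + C * Real.log t) := by
    linarith
  have h7 : 2 * b / √((t : ℝ) + 1) + (u 0 + C * Real.log t) / ((t : ℝ) + 1) =
      (2 * b * √((t : ℝ) + 1) + (u 0 + C * Real.log t)) / ((t : ℝ) + 1) := by
    have h0 : √((t : ℝ) + 1) ≠ 0 := by positivity
    have := Real.sq_sqrt (by positivity : 0 ≤ (t : ℝ) + 1)
    rw [add_div (2 * b * _)]
    congr 1
    rw [div_eq_div_iff h0 (by positivity), mul_assoc (2 * b), ← pow_two, this]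
  rw [h7, le_div_iff₀ (by positivity), mul_comm]
  exact h6

/-- Comparison with the telescoping series of `6/((n+1)(n+2))`, which is tight at `n = 1`. -/
theorem sum_inv_max_sq_le (n : ℕ) :
    ∑ t ∈ Finset.range n, 1 / (((max t 1 : ℕ) : ℝ)) ^ 2 ≤ 6 - 6 / ((n : ℝ) + 1) := by
  induction n with
  | zero => simp
  | succ n ih =>
    rw [Finset.sum_range_succ]
    have h : 1 / (((max n 1 : ℕ) : ℝ)) ^ 2 ≤ 6 / ((n : ℝ) + 1) - 6 / ((n : ℝ) + 1 + 1) := by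
      rcases Nat.eq_zero_or_pos n with rfl | hn
      · norm_num
      · rw [max_eq_left hn]
        have hn' : (1 : ℝ) ≤ n := by exact_mod_cast hn
        rw [div_sub_div _ _ (by positivity) (by positivity), div_le_div_iff₀ (by positivity)
          (by positivity)]
        nlinarith
    rw [Nat.cast_add_one]
    linarith

end Reals

/-! ### The event on which all estimators are accurate. -/

section Setup

variable {d : ℕ} {Θ Ξ : Type*} [MeasurableSpace Θ] [MeasurableSpace Ξ] {p : Problem d Θ Ξ}
  {k : Constants}

theorem Assumptions.oracleF (A : Assumptions p k) : IsOracle p.Z p.P p.F k.D k.Lf k.σf :=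
  ⟨A.convex_Z, A.compact_Z, A.diam_Z, A.prob_P, A.meas_F, A.int_F, A.diff_F, A.diff_f, A.Lf_nonneg,
    A.σf_pos, A.smooth_F, A.noise_gradF⟩

theorem Assumptions.oracleG (A : Assumptions p k) : IsOracle p.Z p.Q p.G k.D k.Lg k.σg :=
  ⟨A.convex_Z, A.compact_Z, A.diam_Z, A.prob_Q, A.meas_G, A.int_G, A.diff_G, A.diff_g, A.Lg_nonneg,
    A.σg_pos, A.smooth_G, A.noise_gradG⟩

/-- The step sizes `1 / (t + 1)`. -/
noncomputable def harmonicWeight (t : ℕ) : ℝ := 1 / ((t : ℝ) + 1)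

theorem harmonicWeight_mem (t : ℕ) : 0 ≤ harmonicWeight t ∧ harmonicWeight t ≤ 1 := by
  unfold harmonicWeight
  exact ⟨by positivity, by rw [div_le_one (by positivity)]; linarith [t.cast_nonneg (α := ℝ)]⟩

/-- The rate of the estimation errors. -/
noncomputable def errorRate (δ : ℝ) (t : ℕ) : ℝ :=
  √(2 * Real.log (6 * (max t 1 : ℕ) / δ)) / √((t : ℝ) + 1)

/-- The STORM estimators at iteration `t` are accurate (the gradients along feasible directions). -/
structure SmallErrors (p : Problem d Θ Ξ) (k : Constants) (δ : ℝ) (x : ℕ → Vec d) (θ : ℕ → Θ)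
    (ξ : ℕ → Ξ) (t : ℕ) : Prop where
  gradF : ‖tangentProj p.Z (storm harmonicWeight p.gradF x θ t - gradient p.f (x t))‖ ≤
    4 * (k.σf + 2 * k.Lf * k.D) * errorRate δ t
  gradG : ‖tangentProj p.Z (storm harmonicWeight p.gradG x ξ t - gradient p.g (x t))‖ ≤
    4 * (k.σg + 2 * k.Lg * k.D) * errorRate δ t
  valG : |storm harmonicWeight p.G x ξ t - p.g (x t)| ≤
    4 * (k.σl + k.D * k.σg + 2 * k.Lg * k.D ^ 2) * errorRate δ t

open Classical in
/-- `y` if it is feasible, and `x₀` otherwise. -/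
noncomputable def feasibleOr (Z : Set (Vec d)) (x₀ y : Vec d) : Vec d := if y ∈ Z then y else x₀

theorem feasibleOr_mem {Z : Set (Vec d)} {x₀ : Vec d} (hx₀ : x₀ ∈ Z) (y : Vec d) :
    feasibleOr Z x₀ y ∈ Z := by
  unfold feasibleOr
  split_ifs with h
  · exact h
  · exact hx₀

theorem feasibleOr_of_mem {Z : Set (Vec d)} (x₀ : Vec d) {y : Vec d} (hy : y ∈ Z) :
    feasibleOr Z x₀ y = y := if_pos hy

theorem measurable_feasibleOr {Z : Set (Vec d)} (hZ : MeasurableSet Z) (x₀ : Vec d) :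
    Measurable (feasibleOr Z x₀) := Measurable.ite hZ measurable_id measurable_const

theorem one_le_log_six_mul {δ : ℝ} (hδ0 : 0 < δ) (hδ1 : δ < 1) {y : ℝ} (hy : 1 ≤ y) :
    1 ≤ Real.log (6 * y / δ) := by
  rw [Real.le_log_iff_exp_le (by positivity)]
  have h1 : 6 ≤ 6 * y / δ := by rw [le_div_iff₀ hδ0]; nlinarith
  linarith [Real.exp_one_lt_d9]

theorem one_le_max_one (t : ℕ) : (1 : ℝ) ≤ (max t 1 : ℕ) := by exact_mod_cast le_max_right t 1

theorem sqrt_le_errorRate {δ : ℝ} (hδ0 : 0 < δ) (hδ1 : δ < 1) (t : ℕ) :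
    √(10 * (1 / 2 + 2 * Real.log (6 * (max t 1 : ℕ) / δ)) / ((t : ℝ) + 1)) ≤ 4 * errorRate δ t := by
  have h1 := one_le_log_six_mul hδ0 hδ1 (one_le_max_one t)
  rw [errorRate, ← Real.sqrt_div' _ (by positivity), show (4 : ℝ) = √(4 ^ 2) by simp,
    ← Real.sqrt_mul (by positivity)]
  apply Real.sqrt_le_sqrt
  rw [← mul_div_assoc]
  -- With `ℓ` the logarithm, `5 + 20 ℓ ≤ 32 ℓ` because `ℓ ≥ 1`; this fixes the factor `4`.
  exact div_le_div_of_nonneg_right (by linarith) (by positivity)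

theorem exp_sub_log_level {δ : ℝ} (hδ0 : 0 < δ) (t : ℕ) :
    Real.exp (1 / 2 - (1 / 2 + 2 * Real.log (6 * (max t 1 : ℕ) / δ))) =
      δ ^ 2 / 36 * (1 / ((max t 1 : ℕ) : ℝ) ^ 2) := by
  have := one_le_max_one t
  have hp : 0 < 6 * ((max t 1 : ℕ) : ℝ) / δ := by positivity
  rw [show 1 / 2 - (1 / 2 + 2 * Real.log (6 * (max t 1 : ℕ) / δ)) =
    -((2 : ℕ) * Real.log (6 * (max t 1 : ℕ) / δ)) by push_cast; ring, Real.exp_neg, Real.exp_nat_mul,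
    Real.exp_log hp]
  field_simp
  norm_num

theorem iterate_succ_sub (x₀ : Vec d) (s : ℕ → Vec d) (t : ℕ) :
    iterate harmonicWeight x₀ s (t + 1) - iterate harmonicWeight x₀ s t =
      (1 / ((t : ℝ) + 2)) • (s t - iterate harmonicWeight x₀ s t) := by
  have e : harmonicWeight (t + 1) = 1 / ((t : ℝ) + 2) := by
    rw [harmonicWeight]; push_cast; congr 1; ring
  rw [iterate, e]
  module

theorem mul_norm_iterate_sub_le {Z : Set (Vec d)} {D : ℝ} (hZ : Convex ℝ Z)
    (hD : ∀ x ∈ Z, ∀ y ∈ Z, ‖x - y‖ ≤ D) {x₀ : Vec d} (hx₀ : x₀ ∈ Z) {s : ℕ → Vec d}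
    (hs : ∀ t, s t ∈ Z) (n : ℕ) :
    (n : ℝ) * ‖iterate harmonicWeight x₀ s n - iterate harmonicWeight x₀ s (n - 1)‖ ≤ D := by
  have hD0 : 0 ≤ D := (norm_nonneg _).trans (hD x₀ hx₀ x₀ hx₀)
  cases n with
  | zero => simpa using hD0
  | succ n =>
    rw [Nat.add_sub_cancel, iterate_succ_sub, norm_smul, Real.norm_of_nonneg (by positivity)]
    have h1 := hD _ (hs n) _ (iterate_mem hZ harmonicWeight_mem hx₀ (t := n) fun i _ => hs i)
    calc ((n + 1 : ℕ) : ℝ) * (1 / ((n : ℝ) + 2) * _)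
        ≤ ((n : ℝ) + 2) * (1 / ((n : ℝ) + 2) * D) := by
          push_cast
          gcongr
          linarith
      _ = D := by field_simp

variable {Ω : Type*} {m : MeasurableSpace Ω} {μ : Measure Ω} [IsProbabilityMeasure μ]
  {ℱ : Filtration ℕ m} {inp : Input d} {θ : ℕ → Ω → Θ} {ξ : ℕ → Ω → Ξ} {s : ℕ → Ω → Vec d}

/-- With high probability, all estimators are accurate at all times. -/
theorem le_measure_smallErrors (A : Assumptions p k) {x₀ : Vec d} (hx₀ : x₀ ∈ p.Z)
    (run : IsRun p inp μ ℱ θ ξ s) {δ : ℝ} (hδ0 : 0 < δ) (hδ1 : δ < 1) :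
    ENNReal.ofReal (1 - δ) ≤ μ {ω | ∀ t, SmallErrors p k δ
      (iterate harmonicWeight x₀ fun i => feasibleOr p.Z x₀ (s i ω))
      (fun i => θ i ω) (fun i => ξ i ω) t} := by
  -- Iterates with directions forced into `Z`: they stay in `Z` for every outcome, including those
  -- with infeasible subproblems.
  set x : ℕ → Ω → Vec d := fun t ω =>
    iterate harmonicWeight x₀ (fun i => feasibleOr p.Z x₀ (s i ω)) t with hxdef
  have hD0 : 0 ≤ k.D := (norm_nonneg _).trans (A.diam_Z x₀ hx₀ x₀ hx₀)
  have hs : ∀ n, Measurable[ℱ n] (fun ω => feasibleOr p.Z x₀ (s n ω)) := fun n =>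
    (measurable_feasibleOr A.compact_Z.measurableSet x₀).comp (run.meas_s n)
  have hx : ∀ n, Measurable[ℱ n] (x (n + 1)) := fun n => by
    induction n with
    | zero =>
      exact (measurable_const (a := (1 - harmonicWeight 1) • x₀)).add
        ((hs 0).const_smul (harmonicWeight 1))
    | succ n ih =>
      exact ((ih.mono (ℱ.mono n.le_succ) le_rfl).const_smul
        (1 - harmonicWeight (n + 2))).add ((hs (n + 1)).const_smul (harmonicWeight (n + 2)))
  have hxZ : ∀ n ω, x n ω ∈ p.Z := fun n ω =>
    iterate_mem A.convex_Z harmonicWeight_mem hx₀ fun i _ => feasibleOr_mem hx₀ _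
  have hxD : ∀ (n : ℕ) ω, (n : ℝ) * ‖x n ω - x (n - 1) ω‖ ≤ k.D := fun n ω =>
    mul_norm_iterate_sub_le A.convex_Z A.diam_Z hx₀ (fun i => feasibleOr_mem hx₀ _) n
  have hindθ : ∀ n, Indep (MeasurableSpace.comap (θ (n + 1)) inferInstance) (ℱ n) μ := fun n => by
    refine indep_of_indep_of_le_left (run.fresh n) ?_
    exact Measurable.comap_le (f := θ (n + 1)) (measurable_fst.comp
      (comap_measurable fun ω => (θ (n + 1) ω, ξ (n + 1) ω)))
  have hindξ : ∀ n, Indep (MeasurableSpace.comap (ξ (n + 1)) inferInstance) (ℱ n) μ := fun n => by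
    refine indep_of_indep_of_le_left (run.fresh n) ?_
    exact Measurable.comap_le (f := ξ (n + 1)) (measurable_snd.comp
      (comap_measurable fun ω => (θ (n + 1) ω, ξ (n + 1) ω)))
  -- Each failure has probability at most `δ²/(36 max(t,1)²)`. Three estimators and the sum over `t`
  -- give `δ²/2 ≤ δ` in total.
  set ℓ : ℕ → ℝ := fun t => 1 / 2 + 2 * Real.log (6 * (max t 1 : ℕ) / δ) with hℓ
  have b1 := fun t => A.oracleF.measure_grad_error_gt_le (μ := μ) (x := x) (x₀ := x₀)
    (fun _ => rfl) hx hxZ hxD run.meas_θ run.law_θ hindθ t (ℓ t)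
  have b2 := fun t => A.oracleG.measure_grad_error_gt_le (μ := μ) (x := x) (x₀ := x₀)
    (fun _ => rfl) hx hxZ hxD run.meas_ξ run.law_ξ hindξ t (ℓ t)
  have b3 := fun t => A.oracleG.measure_value_error_gt_le (μ := μ) (x := x) (x₀ := x₀) A.σl_pos
    A.noise_G (fun _ => rfl) hx hxZ hxD run.meas_ξ run.law_ξ hindξ t (ℓ t)
  have hσf := A.σf_pos
  have hσg := A.σg_pos
  have hσl := A.σl_pos
  have hLf := A.Lf_nonneg
  have hLg := A.Lg_nonneg
  have hbad : ∀ t, μ {ω | ¬ SmallErrors p k δ (fun i => x i ω) (fun i => θ i ω) (fun i => ξ i ω) t} ≤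
      ENNReal.ofReal (δ ^ 2 / 12 * (1 / ((max t 1 : ℕ) : ℝ) ^ 2)) := fun t => by
    have hr := sqrt_le_errorRate hδ0 hδ1 t
    have hmul : ∀ {τ : ℝ}, 0 ≤ τ → τ * √(10 * ℓ t / ((t : ℝ) + 1)) ≤ 4 * τ * errorRate δ t :=
      fun {τ} h => by linarith [mul_le_mul_of_nonneg_left hr h]
    refine (measure_mono fun ω hω => ?_).trans ((measure_union_le _ _).trans (add_le_add
      ((measure_union_le _ _).trans (add_le_add (b1 t) (b2 t))) (b3 t))) |>.trans (le_of_eq ?_)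
    · by_contra hcon
      simp only [Set.mem_union, not_or, Set.mem_ofPred_eq, not_lt] at hcon
      exact hω ⟨hcon.1.1.trans (hmul (by positivity)), hcon.1.2.trans (hmul (by positivity)),
        hcon.2.trans (hmul (by positivity))⟩
    · rw [exp_sub_log_level hδ0, ← ENNReal.ofReal_add (by positivity) (by positivity),
        ← ENNReal.ofReal_add (by positivity) (by positivity)]
      congr 1
      ring
  have hsum : μ {ω | ∀ t, SmallErrors p k δ (fun i => x i ω) (fun i => θ i ω) (fun i => ξ i ω) t}ᶜ ≤
      ENNReal.ofReal δ := by
    have e : {ω | ∀ t, SmallErrors p k δ (fun i => x i ω) (fun i => θ i ω) (fun i => ξ i ω) t}ᶜ =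
        ⋃ t, {ω | ¬ SmallErrors p k δ (fun i => x i ω) (fun i => θ i ω) (fun i => ξ i ω) t} := by
      ext ω; simp
    rw [e]
    refine (measure_iUnion_le _).trans ((ENNReal.tsum_le_tsum hbad).trans
      (ENNReal.tsum_le_of_sum_range_le fun n => ?_))
    rw [← ENNReal.ofReal_sum_of_nonneg fun _ _ => by positivity, ← Finset.mul_sum]
    apply ENNReal.ofReal_le_ofReal
    calc _ ≤ δ ^ 2 / 12 * 6 := by
          gcongr
          have : 0 ≤ 6 / ((n : ℝ) + 1) := by positivity
          linarith [sum_inv_max_sq_le n]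
      _ ≤ δ := by nlinarith
  -- Subadditivity bounds the good event from below without its measurability.
  rw [ENNReal.ofReal_sub _ hδ0.le, ENNReal.ofReal_one, tsub_le_iff_right, ← measure_univ (μ := μ)]
  refine le_trans ?_ (add_le_add le_rfl hsum)
  rw [← Set.union_compl_self {ω | ∀ t, SmallErrors p k δ (fun i => x i ω) (fun i => θ i ω)
    (fun i => ξ i ω) t}]
  exact measure_union_le _ _

end Setup

/-! ### Deterministic analysis on the good event. -/

section Deterministic

variable {d : ℕ} {Θ Ξ : Type*} [MeasurableSpace Θ] [MeasurableSpace Ξ] {p : Problem d Θ Ξ}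
  {k : Constants} {δ : ℝ} {x₀ : Vec d} {θ : ℕ → Θ} {ξ : ℕ → Ξ} {s : ℕ → Vec d} {t : ℕ}

theorem continuousOn_of_differentiableAt {E : Type*} [NormedAddCommGroup E] [NormedSpace ℝ E]
    {φ : E → ℝ} {Z : Set E} (h : ∀ x ∈ Z, DifferentiableAt ℝ φ x) : ContinuousOn φ Z :=
  fun x hx => (h x hx).continuousAt.continuousWithinAt

/-- The bilevel problem has a solution. -/
theorem Assumptions.exists_solution (A : Assumptions p k) (hx₀ : x₀ ∈ p.Z) :
    ∃ z ∈ p.lowerSol, p.fStar = p.f z := by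
  have hg := continuousOn_of_differentiableAt A.diff_g
  obtain ⟨z, hz, hmin⟩ := A.compact_Z.exists_isMinOn ⟨x₀, hx₀⟩ hg
  have e : p.lowerSol = p.Z ∩ p.g ⁻¹' Set.Iic (p.g z) := by
    ext y
    exact ⟨fun h => ⟨h.1, h.2 z hz⟩, fun h => ⟨h.1, fun w hw => le_trans h.2 (hmin hw)⟩⟩
  have hc : IsCompact p.lowerSol := by
    rw [e]
    exact A.compact_Z.of_isClosed_subset
      (hg.preimage_isClosed_of_isClosed A.compact_Z.isClosed isClosed_Iic) Set.inter_subset_left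
  exact hc.exists_sInf_image_eq ⟨z, hz, fun y hy => hmin hy⟩
    ((continuousOn_of_differentiableAt A.diff_f).mono fun y hy => hy.1)

/-- Pairing an estimated gradient with a feasible direction. -/
theorem abs_inner_sub_inner_le (A : Assumptions p k) {v w x y : Vec d} {r : ℝ}
    (h : ‖tangentProj p.Z (v - w)‖ ≤ r) (hx : x ∈ p.Z) (hy : y ∈ p.Z) :
    |inner ℝ v (y - x) - inner ℝ w (y - x)| ≤ k.D * r := by
  rw [← inner_sub_left, ← inner_tangentProj_sub hx hy, mul_comm]
  refine (abs_real_inner_le_norm _ _).trans ?_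
  have hr : 0 ≤ r := (norm_nonneg _).trans h
  gcongr
  exact A.diam_Z y hy x hx

theorem sqrt_log_le_sqrt_log_mul (hd : 1 ≤ d) (hδ0 : 0 < δ) (t : ℕ) :
    √(2 * Real.log (6 * (max t 1 : ℕ) / δ)) ≤ √(2 * Real.log (6 * (max t 1 : ℕ) * d / δ)) := by
  have hd' : (1 : ℝ) ≤ d := by exact_mod_cast hd
  have ht := one_le_max_one t
  have h : 6 * ((max t 1 : ℕ) : ℝ) ≤ 6 * (max t 1 : ℕ) * d := le_mul_of_one_le_right (by positivity) hd'
  apply Real.sqrt_le_sqrt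
  gcongr

/-- The shift must pay for the value error and one gradient pairing together. The constant `10`
suffices: the coefficients to compare are `4 ≤ 15` for `σl`, `8 ≤ 15` for `D σg` and `16 ≤ 20` for
`Lg D²`. -/
theorem le_shift (A : Assumptions p k) (hD : 0 ≤ k.D) (hd : 1 ≤ d) (hδ0 : 0 < δ) (t : ℕ) :
    4 * (k.σl + k.D * k.σg + 2 * k.Lg * k.D ^ 2) * errorRate δ t
      + k.D * (4 * (k.σg + 2 * k.Lg * k.D) * errorRate δ t) ≤ shift k 10 d δ t := by
  have hσg := A.σg_pos
  have hσl := A.σl_pos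
  have hLg := A.Lg_nonneg
  have hLl := A.Ll_nonneg
  have hmono := sqrt_log_le_sqrt_log_mul hd hδ0 t
  rw [shift, errorRate]
  set R := √(2 * Real.log (6 * (max t 1 : ℕ) / δ)) with hR
  have hR0 : 0 ≤ R := Real.sqrt_nonneg _
  have e : 4 * (k.σl + k.D * k.σg + 2 * k.Lg * k.D ^ 2) * (R / √((t : ℝ) + 1))
      + k.D * (4 * (k.σg + 2 * k.Lg * k.D) * (R / √((t : ℝ) + 1))) =
      (4 * (k.σl + 2 * (k.D * (k.σg + 2 * k.Lg * k.D))) * R) / √((t : ℝ) + 1) := by ring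
  rw [e]
  refine div_le_div_of_nonneg_right ?_ (Real.sqrt_nonneg _)
  calc 4 * (k.σl + 2 * (k.D * (k.σg + 2 * k.Lg * k.D))) * R
      ≤ 10 * ((2 * k.Ll * k.D + 3 / 2 * k.σl) * R
        + k.D * (2 * k.Lg * k.D + 3 / 2 * k.σg) * R) := by
        have h1 : 0 ≤ k.Ll * k.D * R := by positivity
        have h2 : 0 ≤ k.σl * R := by positivity
        have h3 : 0 ≤ k.D * k.σg * R := by positivity
        have h4 : 0 ≤ k.D * k.Lg * k.D * R := by positivity
        linarith
    _ ≤ _ := by gcongr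

/-- On accurate iterations all lower-level solutions are feasible for the subproblem. -/
theorem lowerSol_subset_feasibleSet (A : Assumptions p k) (hx₀ : x₀ ∈ p.Z) (hd : 1 ≤ d)
    (hδ0 : 0 < δ) (hx : iterate harmonicWeight x₀ s t ∈ p.Z)
    (h : SmallErrors p k δ (iterate harmonicWeight x₀ s) θ ξ t) :
    p.lowerSol ⊆ feasibleSet p (stdInput k 10 δ x₀) ξ s t := by
  intro z hz
  have hD0 : 0 ≤ k.D := (norm_nonneg _).trans (A.diam_Z x₀ hx₀ x₀ hx₀)
  refine ⟨hz.1, ?_⟩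
  change inner ℝ (storm harmonicWeight p.gradG (iterate harmonicWeight x₀ s) ξ t)
    (z - iterate harmonicWeight x₀ s t) ≤
    p.g x₀ - storm harmonicWeight p.G (iterate harmonicWeight x₀ s) ξ t + shift k 10 d δ t
  -- With exact data, convexity gives `⟪∇g(x), z - x⟫ ≤ g z - g x ≤ g x₀ - g x`; the shift covers
  -- the two estimation errors.
  have h1 := (abs_le.mp (abs_inner_sub_inner_le A h.gradG hx hz.1)).2
  have h2 := (abs_le.mp h.valG).2
  have h3 := inner_gradient_le_of_convexOn A.convex_g hx hz.1 (A.diff_g _ hx)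
  have h4 := hz.2 x₀ hx₀
  have h5 := le_shift A hD0 hd hδ0 t
  linarith

/-- If the estimators along the truncated iterates are accurate, then the truncation is void. -/
theorem mem_of_smallErrors (A : Assumptions p k) (hx₀ : x₀ ∈ p.Z) (hd : 1 ≤ d) (hδ0 : 0 < δ)
    (horacle : ∀ t, (feasibleSet p (stdInput k 10 δ x₀) ξ s t).Nonempty →
      s t ∈ feasibleSet p (stdInput k 10 δ x₀) ξ s t)
    (h : ∀ t, SmallErrors p k δ
      (iterate harmonicWeight x₀ fun i => feasibleOr p.Z x₀ (s i)) θ ξ t) :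
    (∀ t, s t ∈ p.Z) ∧ ∀ t, SmallErrors p k δ (iterate harmonicWeight x₀ s) θ ξ t := by
  obtain ⟨z, hz, -⟩ := A.exists_solution hx₀
  -- The estimates at time `t` involve only directions before `t`. If those lie in `Z`, truncated
  -- and true estimates agree, the subproblem is feasible, and the oracle returns a point of `Z`.
  have key : ∀ t, s t ∈ p.Z := by
    intro t
    induction t using Nat.strong_induction_on with
    | _ t ih =>
      have hxe : ∀ i ≤ t, iterate harmonicWeight x₀ (fun i => feasibleOr p.Z x₀ (s i)) i =
          iterate harmonicWeight x₀ s i := fun i hi =>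
        iterate_congr _ _ fun j hj => feasibleOr_of_mem _ (ih j (hj.trans_le hi))
      have ht := h t
      have ht' : SmallErrors p k δ (iterate harmonicWeight x₀ s) θ ξ t := by
        refine ⟨?_, ?_, ?_⟩
        · rw [← hxe t le_rfl, ← storm_congr harmonicWeight p.gradF θ hxe]; exact ht.gradF
        · rw [← hxe t le_rfl, ← storm_congr harmonicWeight p.gradG ξ hxe]; exact ht.gradG
        · rw [← hxe t le_rfl, ← storm_congr harmonicWeight p.G ξ hxe]; exact ht.valG
      exact (horacle t ⟨z, lowerSol_subset_feasibleSet A hx₀ hd hδ0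
        (iterate_mem A.convex_Z harmonicWeight_mem hx₀ ih) ht' hz⟩).1
  refine ⟨key, ?_⟩
  have e : (fun i => feasibleOr p.Z x₀ (s i)) = s := funext fun i => feasibleOr_of_mem _ (key i)
  rwa [e] at h

theorem descent (A : Assumptions p k) {S : Type*} [MeasurableSpace S] {P : Measure S}
    {F : Vec d → S → ℝ} {L σ : ℝ} (h : IsOracle p.Z P F k.D L σ) (hx₀ : x₀ ∈ p.Z)
    (hs : ∀ t, s t ∈ p.Z) (t : ℕ) :
    (∫ z, F (iterate harmonicWeight x₀ s (t + 1)) z ∂P) ≤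
      (∫ z, F (iterate harmonicWeight x₀ s t) z ∂P) + 1 / ((t : ℝ) + 2) *
        inner ℝ (gradient (fun y => ∫ z, F y z ∂P) (iterate harmonicWeight x₀ s t))
          (s t - iterate harmonicWeight x₀ s t) + L * k.D ^ 2 * (1 / ((t : ℝ) + 2)) ^ 2 := by
  have hx : ∀ t, iterate harmonicWeight x₀ s t ∈ p.Z := fun t =>
    iterate_mem A.convex_Z harmonicWeight_mem hx₀ fun i _ => hs i
  have h1 := (abs_le.mp (h.mean_taylor (hx t) (hx (t + 1)))).2
  rw [iterate_succ_sub, inner_smul_right, norm_smul, Real.norm_of_nonneg (by positivity)] at h1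
  have hL := h.L_nonneg
  have h2 : L * (1 / ((t : ℝ) + 2) * ‖s t - iterate harmonicWeight x₀ s t‖) ^ 2 ≤
      L * (1 / ((t : ℝ) + 2) * k.D) ^ 2 := by
    gcongr
    exact A.diam_Z _ (hs t) _ (hx t)
  nlinarith

/-- Freezing the logarithm at the final time makes the coefficient `b` of the recursion constant. -/
theorem sqrt_log_le_zeta (hδ0 : 0 < δ) (hd : 1 ≤ d) (ht : 1 ≤ t) {i : ℕ} (hi : i < t) :
    √(2 * Real.log (6 * (max i 1 : ℕ) * d / δ)) ≤ √2 * zeta d δ t := by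
  have hd' : (1 : ℝ) ≤ d := by exact_mod_cast hd
  have h1 := one_le_max_one i
  have h2 : ((max i 1 : ℕ) : ℝ) ≤ t := by exact_mod_cast max_le hi.le ht
  rw [zeta, ← Real.sqrt_mul (by norm_num)]
  gcongr

theorem one_le_zeta (hδ0 : 0 < δ) (hδ1 : δ < 1) (hd : 1 ≤ d) (ht : 1 ≤ t) : 1 ≤ zeta d δ t := by
  have hd' : (1 : ℝ) ≤ d := by exact_mod_cast hd
  have ht' : (1 : ℝ) ≤ t := by exact_mod_cast ht
  rw [zeta, Real.one_le_sqrt, mul_assoc]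
  exact one_le_log_six_mul hδ0 hδ1 (by nlinarith)

/-- The cut compares with `g x₀`, so the recursion is for `g(x_i) - g x₀`. One shift comes from the
cut and a second one bounds the errors, whence the factor `2` in `b`. -/
theorem lower_rate (A : Assumptions p k) (hx₀ : x₀ ∈ p.Z) (hd : 1 ≤ d) (hδ0 : 0 < δ) (hδ1 : δ < 1)
    (hs : ∀ t, s t ∈ feasibleSet p (stdInput k 10 δ x₀) ξ s t)
    (h : ∀ t, SmallErrors p k δ (iterate harmonicWeight x₀ s) θ ξ t) (ht : 1 ≤ t) :
    p.g (iterate harmonicWeight x₀ s t) - p.g x₀ ≤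
      lowerConst k 10 * zeta d δ t / √((t : ℝ) + 1)
        + k.Lg * k.D ^ 2 * Real.log t / ((t : ℝ) + 1) := by
  have hsZ : ∀ t, s t ∈ p.Z := fun t => (hs t).1
  have hx : ∀ t, iterate harmonicWeight x₀ s t ∈ p.Z := fun t =>
    iterate_mem A.convex_Z harmonicWeight_mem hx₀ fun i _ => hsZ i
  have hD0 : 0 ≤ k.D := (norm_nonneg _).trans (A.diam_Z x₀ hx₀ x₀ hx₀)
  have hσg := A.σg_pos
  have hσl := A.σl_pos
  have hLg := A.Lg_nonneg
  have hLl := A.Ll_nonneg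
  have hz1 := one_le_zeta hδ0 hδ1 hd ht
  have hs2 : (1 : ℝ) ≤ √2 := Real.one_le_sqrt.mpr (by norm_num)
  set B := 2 * k.Ll * k.D + 3 / 2 * k.σl + k.D * (2 * k.Lg * k.D + 3 / 2 * k.σg) with hB
  have hB0 : 0 ≤ B := by positivity
  have key := rate_of_recursion (u := fun i => p.g (iterate harmonicWeight x₀ s i) - p.g x₀)
    (b := 2 * (10 * (B * (√2 * zeta d δ t)))) (C := k.Lg * k.D ^ 2) ht (by positivity) (by
      have h1 : k.Lg * k.D ^ 2 ≤ B := by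
        rw [hB]
        have : 0 ≤ 2 * k.Ll * k.D + 3 / 2 * k.σl + k.D * (3 / 2 * k.σg) := by positivity
        have : 0 ≤ k.Lg * k.D ^ 2 := by positivity
        linarith
      have h2 : B * 1 ≤ B * (√2 * zeta d δ t) := by gcongr; nlinarith
      linarith)
    (fun i hi => ?_)
  · have e : 2 * (2 * (10 * (B * (√2 * zeta d δ t)))) = lowerConst k 10 * zeta d δ t := by
      rw [lowerConst, hB]; ring
    rw [e] at key
    simpa [iterate] using key
  · have h1 := descent A A.oracleG hx₀ hsZ i
    change p.g _ ≤ p.g _ + 1 / ((i : ℝ) + 2) * inner ℝ (gradient p.g _) _ + _ at h1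
    have h2 := (abs_le.mp (abs_inner_sub_inner_le A (h i).gradG (hx i) (hsZ i))).1
    have h3 := (abs_le.mp (h i).valG).1
    have h4 : inner ℝ (storm harmonicWeight p.gradG (iterate harmonicWeight x₀ s) ξ i)
      (s i - iterate harmonicWeight x₀ s i) ≤
      p.g x₀ - storm harmonicWeight p.G (iterate harmonicWeight x₀ s) ξ i + shift k 10 d δ i :=
      (hs i).2
    have h5 := le_shift A hD0 hd hδ0 i
    have h6 : shift k 10 d δ i ≤ 10 * (B * (√2 * zeta d δ t)) / √((i : ℝ) + 1) := by
      have hz := sqrt_log_le_zeta hδ0 hd ht hi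
      have hmono := (sqrt_log_le_sqrt_log_mul hd hδ0 i).trans hz
      rw [shift, hB, add_mul (2 * k.Ll * k.D + 3 / 2 * k.σl)]
      gcongr
    have h7 : inner ℝ (gradient p.g (iterate harmonicWeight x₀ s i))
        (s i - iterate harmonicWeight x₀ s i) ≤
        -(p.g (iterate harmonicWeight x₀ s i) - p.g x₀) +
          2 * (10 * (B * (√2 * zeta d δ t))) / √((i : ℝ) + 1) := by
      rw [mul_div_assoc]
      linarith
    have h8 := mul_le_mul_of_nonneg_left h7 (by positivity : 0 ≤ 1 / ((i : ℝ) + 2))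
    linarith

theorem upper_rate (A : Assumptions p k) (hf : ConvexOn ℝ p.Z p.f) (hx₀ : x₀ ∈ p.Z) (hd : 1 ≤ d)
    (hδ0 : 0 < δ) (hδ1 : δ < 1)
    (hs : ∀ t, s t ∈ feasibleSet p (stdInput k 10 δ x₀) ξ s t)
    (hmin : ∀ t, ∀ y ∈ feasibleSet p (stdInput k 10 δ x₀) ξ s t,
      inner ℝ (storm harmonicWeight p.gradF (iterate harmonicWeight x₀ s) θ t) (s t) ≤
        inner ℝ (storm harmonicWeight p.gradF (iterate harmonicWeight x₀ s) θ t) y)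
    (h : ∀ t, SmallErrors p k δ (iterate harmonicWeight x₀ s) θ ξ t) (ht : 1 ≤ t) :
    p.f (iterate harmonicWeight x₀ s t) - p.fStar ≤
      upperConst k 10 * zeta d δ t / √((t : ℝ) + 1)
        + (p.f x₀ - p.fStar + k.Lf * k.D ^ 2 * Real.log t) / ((t : ℝ) + 1) := by
  have hsZ : ∀ t, s t ∈ p.Z := fun t => (hs t).1
  have hx : ∀ t, iterate harmonicWeight x₀ s t ∈ p.Z := fun t =>
    iterate_mem A.convex_Z harmonicWeight_mem hx₀ fun i _ => hsZ i
  have hD0 : 0 ≤ k.D := (norm_nonneg _).trans (A.diam_Z x₀ hx₀ x₀ hx₀)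
  have hσf := A.σf_pos
  have hLf := A.Lf_nonneg
  have hz1 := one_le_zeta hδ0 hδ1 hd ht
  have hs2 : (1 : ℝ) ≤ √2 := Real.one_le_sqrt.mpr (by norm_num)
  obtain ⟨z, hz, hzf⟩ := A.exists_solution hx₀
  set B := k.D * (2 * k.Lf * k.D + 3 / 2 * k.σf) with hB
  have hB0 : 0 ≤ B := by positivity
  have key := rate_of_recursion (u := fun i => p.f (iterate harmonicWeight x₀ s i) - p.fStar)
    (b := 10 * (B * (√2 * zeta d δ t))) (C := k.Lf * k.D ^ 2) ht (by positivity) (by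
      have h1 : k.Lf * k.D ^ 2 ≤ B := by
        rw [hB]
        have : 0 ≤ k.D * (3 / 2 * k.σf) := by positivity
        have : 0 ≤ k.Lf * k.D ^ 2 := by positivity
        linarith
      have h2 : B * 1 ≤ B * (√2 * zeta d δ t) := by gcongr; nlinarith
      linarith)
    (fun i hi => ?_)
  · have e : 2 * (10 * (B * (√2 * zeta d δ t))) = upperConst k 10 * zeta d δ t := by
      rw [upperConst, hB]; ring
    rw [e] at key
    simpa [iterate] using key
  · have h1 := descent A A.oracleF hx₀ hsZ i
    change p.f _ ≤ p.f _ + 1 / ((i : ℝ) + 2) * inner ℝ (gradient p.f _) _ + _ at h1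
    have hzi := lowerSol_subset_feasibleSet A hx₀ hd hδ0 (hx i) (h i) hz
    have h2 := hmin i z hzi
    -- The gradient error is paired with `z - s i` directly, so the diameter enters only once.
    have h3 := (abs_le.mp (abs_inner_sub_inner_le A (h i).gradF (hsZ i) hz.1)).2
    have h4 := inner_gradient_le_of_convexOn hf (hx i) hz.1 (A.diff_f _ (hx i))
    have h6 : k.D * (4 * (k.σf + 2 * k.Lf * k.D) * errorRate δ i) ≤
        10 * (B * (√2 * zeta d δ t)) / √((i : ℝ) + 1) := by
      have hmono := (sqrt_log_le_sqrt_log_mul hd hδ0 i).trans (sqrt_log_le_zeta hδ0 hd ht hi)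
      rw [errorRate, mul_div_assoc', mul_div_assoc']
      refine div_le_div_of_nonneg_right ?_ (Real.sqrt_nonneg _)
      calc k.D * (4 * (k.σf + 2 * k.Lf * k.D) * √(2 * Real.log (6 * (max i 1 : ℕ) / δ)))
          ≤ k.D * (4 * (k.σf + 2 * k.Lf * k.D) * (√2 * zeta d δ t)) := by gcongr
        _ ≤ _ := by
          rw [hB]
          have h1 : 0 ≤ k.D * (k.Lf * k.D) * (√2 * zeta d δ t) := by positivity
          have h2 : 0 ≤ k.D * k.σf * (√2 * zeta d δ t) := by positivity
          linarith
    simp only [inner_sub_right] at h1 h3 h4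
    have h7 : inner ℝ (gradient p.f (iterate harmonicWeight x₀ s i))
        (s i - iterate harmonicWeight x₀ s i) ≤
        -(p.f (iterate harmonicWeight x₀ s i) - p.fStar) +
          10 * (B * (√2 * zeta d δ t)) / √((i : ℝ) + 1) := by
      rw [inner_sub_right, hzf]
      linarith
    rw [inner_sub_right] at h7
    have h8 := mul_le_mul_of_nonneg_left h7 (by positivity : 0 ≤ 1 / ((i : ℝ) + 2))
    linarith

end Deterministic

/-! ### Feasibility and rates combined. -/

section Convergence

/-- Feasibility of all subproblems and convergence rates, with high probability. -/
theorem le_measure_feasible_and_rates {d : ℕ} {Θ Ξ Ω : Type*} [MeasurableSpace Θ]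
    [MeasurableSpace Ξ] [m : MeasurableSpace Ω]
    {p : Problem d Θ Ξ} {k : Constants} {x₀ : Vec d} {εg δ : ℝ}
    {μ : Measure Ω} [IsProbabilityMeasure μ] {ℱ : Filtration ℕ m}
    {θ : ℕ → Ω → Θ} {ξ : ℕ → Ω → Ξ} {s : ℕ → Ω → Vec d}
    (hd : 1 ≤ d) (A : Assumptions p k) (hf : ConvexOn ℝ p.Z p.f)
    (hx₀ : x₀ ∈ p.Z) (hε : p.g x₀ - p.gStar ≤ εg / 2) (hδ0 : 0 < δ) (hδ1 : δ < 1)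
    (run : IsRun p (stdInput k 10 δ x₀) μ ℱ θ ξ s) :
    ENNReal.ofReal (1 - δ) ≤ μ {ω |
      (∀ t : ℕ,
        (feasibleSet p (stdInput k 10 δ x₀) (fun i => ξ i ω) (fun i => s i ω) t).Nonempty) ∧
      (∀ t : ℕ, iterate (stdInput k 10 δ x₀).γ x₀ (fun i => s i ω) t ∈ p.Z) ∧
      (∀ t : ℕ, 1 ≤ t →
        p.g (iterate (stdInput k 10 δ x₀).γ x₀ (fun i => s i ω) t) - p.gStar ≤
          lowerConst k 10 * zeta d δ t / √((t : ℝ) + 1)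
            + k.Lg * k.D ^ 2 * Real.log t / ((t : ℝ) + 1) + εg / 2 ∧
        p.f (iterate (stdInput k 10 δ x₀).γ x₀ (fun i => s i ω) t) - p.fStar ≤
          upperConst k 10 * zeta d δ t / √((t : ℝ) + 1)
            + (p.f x₀ - p.fStar + k.Lf * k.D ^ 2 * Real.log t) / ((t : ℝ) + 1))} := by
  refine (le_measure_smallErrors A hx₀ run hδ0 hδ1).trans (measure_mono fun ω hω => ?_)
  obtain ⟨hsZ, hsmall⟩ := mem_of_smallErrors A hx₀ hd hδ0 (fun t ht => (run.oracle t ω ht).1) hω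
  have hxZ : ∀ t, iterate harmonicWeight x₀ (fun i => s i ω) t ∈ p.Z := fun t =>
    iterate_mem A.convex_Z harmonicWeight_mem hx₀ fun i _ => hsZ i
  obtain ⟨z, hz, -⟩ := A.exists_solution hx₀
  have hne : ∀ t : ℕ,
      (feasibleSet p (stdInput k 10 δ x₀) (fun i => ξ i ω) (fun i => s i ω) t).Nonempty :=
    fun t => ⟨z, lowerSol_subset_feasibleSet A hx₀ hd hδ0 (hxZ t) (hsmall t) hz⟩
  have hs := fun t => (run.oracle t ω (hne t)).1
  have hmin := fun t => (run.oracle t ω (hne t)).2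
  refine ⟨hne, hxZ, fun t ht => ⟨?_, upper_rate A hf hx₀ hd hδ0 hδ1 hs hmin hsmall ht⟩⟩
  have h := lower_rate A hx₀ hd hδ0 hδ1 hs hsmall ht
  change p.g (iterate harmonicWeight x₀ (fun i => s i ω) t) - p.gStar ≤ _
  linarith

end Convergence

/-! ### From rates to sample complexity. -/

section Complexity

theorem log_le_two_mul_sqrt {w : ℝ} (hw : 0 < w) : Real.log w ≤ 2 * √w := by
  have h1 : Real.log w = 2 * Real.log (√w) := by rw [Real.log_sqrt hw.le]; ring
  have h2 := Real.log_le_sub_one_of_pos (Real.sqrt_pos.mpr hw)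
  linarith

/-- The restriction `ε ≤ 1/2` keeps the logarithm away from zero, so constants can be absorbed into
it. -/
theorem half_le_log_div {d : ℕ} {δ ε : ℝ} (hd : 1 ≤ d) (hδ0 : 0 < δ) (hδ1 : δ < 1) (hε0 : 0 < ε)
    (hε1 : ε ≤ 1 / 2) : 1 / 2 ≤ Real.log (d / (δ * ε)) := by
  have hd' : (1 : ℝ) ≤ d := by exact_mod_cast hd
  have h2 : (2 : ℝ) ≤ d / (δ * ε) := by rw [le_div_iff₀ (by positivity)]; nlinarith
  have := Real.log_le_log (by norm_num) h2
  linarith [Real.log_two_gt_d9]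

/-- The logarithmic factor is absorbed after `O(log(d/(δε))/ε²)` iterations. -/
theorem exists_log_le_mul (η : ℝ) (hη : 0 < η) : ∃ M : ℝ, 1 ≤ M ∧
    ∀ (d : ℕ) (δ ε : ℝ) (t : ℕ), 1 ≤ d → 0 < δ → δ < 1 → 0 < ε → ε ≤ 1 / 2 →
      M * Real.log (d / (δ * ε)) / ε ^ 2 ≤ t → Real.log (6 * t * d / δ) ≤ η * ε ^ 2 * t := by
  refine ⟨max 1 ((20 / η) ^ 2), le_max_left _ _, fun d δ ε t hd hδ0 hδ1 hε0 hε1 ht => ?_⟩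
  set M := max 1 ((20 / η) ^ 2) with hM
  have hM1 : 1 ≤ M := le_max_left _ _
  have hMη : 20 ≤ η * √M := by
    have : 20 / η ≤ √M := Real.le_sqrt_of_sq_le (le_max_right _ _)
    rwa [div_le_iff₀ hη, mul_comm] at this
  have hd' : (1 : ℝ) ≤ d := by exact_mod_cast hd
  have hl := half_le_log_div hd hδ0 hδ1 hε0 hε1
  set l := Real.log (d / (δ * ε)) with hldef
  rw [div_le_iff₀ (by positivity)] at ht
  have hMl : 0 < M * l := by positivity
  have ht0 : (0 : ℝ) < t := by
    by_contra h
    have : (t : ℝ) * ε ^ 2 ≤ 0 := mul_nonpos_of_nonpos_of_nonneg (not_lt.mp h) (by positivity)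
    linarith
  -- In terms of `w = t ε² ≥ M l` the left side is at most `2 + 2 √w + 2 l`. Multiplied by `√M`,
  -- every term is `O(w)`, because `√M ≤ M` and `l ≥ 1/2`; `20` is a generous total.
  have e : Real.log (6 * t * d / δ) = Real.log 6 + Real.log (t * ε ^ 2) - Real.log ε + l := by
    rw [hldef, Real.log_div (by positivity) (by positivity), Real.log_mul (by positivity)
      (by positivity), Real.log_mul (by positivity) (by positivity), Real.log_mul (by positivity)
      (by positivity), Real.log_div (by positivity) (by positivity), Real.log_mul (by positivity)
      (by positivity), Real.log_pow]
    push_cast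
    ring
  have hε : -Real.log ε ≤ l := by
    rw [hldef, Real.log_div (by positivity) (by positivity), Real.log_mul (by positivity)
      (by positivity)]
    have := Real.log_nonneg hd'
    have := Real.log_nonpos hδ0.le hδ1.le
    linarith
  have h6 : Real.log 6 ≤ 2 := by
    rw [Real.log_le_iff_le_exp (by norm_num)]
    have h := Real.exp_one_gt_d9
    have : Real.exp 2 = Real.exp 1 * Real.exp 1 := by rw [← Real.exp_add]; norm_num
    nlinarith
  set w := (t : ℝ) * ε ^ 2 with hw
  have hw0 : 0 < w := by positivity
  have h1 := log_le_two_mul_sqrt hw0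
  have hsM : 1 ≤ √M := Real.one_le_sqrt.mpr hM1
  have hMM := Real.mul_self_sqrt (by positivity : 0 ≤ M)
  have hww := Real.mul_self_sqrt hw0.le
  have h2 : √M ≤ 2 * √w := by
    rw [show (2 : ℝ) = √(2 ^ 2) by simp, ← Real.sqrt_mul (by positivity)]
    apply Real.sqrt_le_sqrt
    nlinarith
  have h3 : √M * √w ≤ 2 * w := by nlinarith [Real.sqrt_nonneg w]
  have h4 : √M * l ≤ w := by nlinarith
  have h5 : √M * Real.log (6 * t * d / δ) ≤ 20 * w := by
    rw [e]
    nlinarith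
  have h7 : √M * Real.log (6 * t * d / δ) ≤ √M * (η * w) := by nlinarith
  have := le_of_mul_le_mul_left h7 (by linarith)
  rw [hw] at this
  linarith

/-- After `T` iterations the error bounds are below the tolerance. -/
theorem exists_tolerance (R : ℝ) (hR : 1 ≤ R) : ∃ M : ℝ, 1 ≤ M ∧
    ∀ (d : ℕ) (δ ε : ℝ) (t : ℕ), 1 ≤ d → 0 < δ → δ < 1 → 0 < ε → ε ≤ 1 / 2 →
      M * Real.log (d / (δ * ε)) / ε ^ 2 ≤ t → ∀ a b c : ℝ, |a| ≤ R → |b| ≤ R → |c| ≤ R →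
        1 ≤ t ∧ a * zeta d δ t / √((t : ℝ) + 1) + (b + c * Real.log t) / ((t : ℝ) + 1) ≤ ε / 2 := by
  -- This `η` makes `ζ/√(t+1) ≤ ε/(6R)`, and it also brings the logarithmic term below `ε/6`. The
  -- target is `ε/2` since the lower level already carries `εg/2` from the start.
  obtain ⟨M, hM, h⟩ := exists_log_le_mul ((1 / (6 * R)) ^ 2) (by positivity)
  refine ⟨M, hM, fun d δ ε t hd hδ0 hδ1 hε0 hε1 ht a b c ha hb hc => ?_⟩
  have hl := half_le_log_div hd hδ0 hδ1 hε0 hε1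
  have ht1 : 1 ≤ t := by
    by_contra hcon
    rw [not_le, Nat.lt_one_iff] at hcon
    rw [hcon, Nat.cast_zero] at ht
    have : 0 < M * Real.log (d / (δ * ε)) / ε ^ 2 := by positivity
    linarith
  refine ⟨ht1, ?_⟩
  have hlog := h d δ ε t hd hδ0 hδ1 hε0 hε1 ht
  have hd' : (1 : ℝ) ≤ d := by exact_mod_cast hd
  have ht' : (1 : ℝ) ≤ t := by exact_mod_cast ht1
  set l := Real.log (6 * t * d / δ) with hldef
  have hl1 : 1 ≤ l := by
    rw [hldef, mul_assoc]; exact one_le_log_six_mul hδ0 hδ1 (by nlinarith)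
  have hlt : Real.log t ≤ l := by
    rw [hldef]
    apply Real.log_le_log (by positivity)
    rw [le_div_iff₀ hδ0]
    nlinarith
  have hlt0 := Real.log_nonneg ht'
  have hz : zeta d δ t / √((t : ℝ) + 1) ≤ ε / (6 * R) := by
    rw [zeta, ← Real.sqrt_div' _ (by positivity)]
    apply Real.sqrt_le_iff.mpr
    refine ⟨by positivity, ?_⟩
    rw [div_le_iff₀ (by positivity), ← hldef]
    calc l ≤ (1 / (6 * R)) ^ 2 * ε ^ 2 * t := hlog
      _ = (ε / (6 * R)) ^ 2 * t := by ring
      _ ≤ _ := by gcongr; linarith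
  have hz0 : 0 ≤ zeta d δ t / √((t : ℝ) + 1) := by unfold zeta; positivity
  have h1 : a * zeta d δ t / √((t : ℝ) + 1) ≤ ε / 6 := by
    rw [mul_div_assoc]
    calc _ ≤ R * (ε / (6 * R)) := by
          gcongr
          exact (le_abs_self a).trans ha
      _ = ε / 6 := by field_simp
  have h2 : (b + c * Real.log t) / ((t : ℝ) + 1) ≤ ε / 6 := by
    rw [div_le_iff₀ (by positivity)]
    have h3 : b + c * Real.log t ≤ 2 * R * l := by
      have h4 : c * Real.log t ≤ R * l := by
        calc c * Real.log t ≤ R * Real.log t := by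
              gcongr
              exact (le_abs_self c).trans hc
          _ ≤ R * l := by gcongr
      have h5 : b ≤ R * l := by nlinarith [le_abs_self b]
      linarith
    have h6 : 2 * R * l ≤ 2 * R * ((1 / (6 * R)) ^ 2 * ε ^ 2 * t) := by gcongr
    have h7 : 2 * R * ((1 / (6 * R)) ^ 2 * ε ^ 2 * t) = ε * t / R * (ε / 18) := by field_simp; ring
    have h8 : ε * t / R * (ε / 18) ≤ ε * t * (ε / 18) := by
      gcongr
      exact div_le_self (by positivity) hR
    have h9 : ε * t * (ε / 18) ≤ ε / 6 * (t + 1) := by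
      have : ε * t * (ε / 18) ≤ ε * t * (1 / 18) := by gcongr; linarith
      have : 0 ≤ ε * t := by positivity
      linarith
    linarith
  linarith

theorem sampleCount_eq (T : ℕ) : sampleCount T = 2 * T := by
  simp [sampleCount, mul_comm]

end Complexity

end SimpleBilevel

/-! ### The main theorem. -/

open SimpleBilevel in
theorem mainTheorem1 :
    ∃ c : ℝ, 0 < c ∧
      -- convergence rates
      (∀ (d : ℕ) (Θ Ξ Ω : Type*) [MeasurableSpace Θ] [MeasurableSpace Ξ] [m : MeasurableSpace Ω]
        (p : Problem d Θ Ξ) (k : Constants) (x₀ : Vec d) (εg δ : ℝ)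
        (μ : Measure Ω) [IsProbabilityMeasure μ] (ℱ : Filtration ℕ m)
        (θ : ℕ → Ω → Θ) (ξ : ℕ → Ω → Ξ) (s : ℕ → Ω → Vec d),
        1 ≤ d → Assumptions p k → ConvexOn ℝ p.Z p.f →
        x₀ ∈ p.Z → p.g x₀ - p.gStar ≤ εg / 2 → 0 < δ → δ < 1 →
        IsRun p (stdInput k c δ x₀) μ ℱ θ ξ s →
        ENNReal.ofReal (1 - δ) ≤ μ {ω |
          (∀ t : ℕ,
            (feasibleSet p (stdInput k c δ x₀) (fun i => ξ i ω) (fun i => s i ω) t).Nonempty) ∧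
          (∀ t : ℕ, 1 ≤ t →
            p.g (iterate (stdInput k c δ x₀).γ x₀ (fun i => s i ω) t) - p.gStar ≤
              lowerConst k c * zeta d δ t / √((t : ℝ) + 1)
                + k.Lg * k.D ^ 2 * Real.log t / ((t : ℝ) + 1) + εg / 2 ∧
            p.f (iterate (stdInput k c δ x₀).γ x₀ (fun i => s i ω) t) - p.fStar ≤
              upperConst k c * zeta d δ t / √((t : ℝ) + 1)
                + (p.f x₀ - p.fStar + k.Lf * k.D ^ 2 * Real.log t) / ((t : ℝ) + 1))}) ∧
      -- sample complexity
      (∀ (k : Constants) (Δ : ℝ), ∃ M : ℝ, 0 < M ∧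
        ∀ (d : ℕ) (εf εg δ : ℝ), 1 ≤ d → 0 < min εf εg → min εf εg ≤ 1 / 2 → 0 < δ → δ < 1 →
        ∃ T : ℕ,
          (sampleCount T : ℝ) ≤ M * Real.log (d / (δ * min εf εg)) / (min εf εg) ^ 2 ∧
          ∀ (Θ Ξ Ω : Type*) [MeasurableSpace Θ] [MeasurableSpace Ξ] [m : MeasurableSpace Ω]
            (p : Problem d Θ Ξ) (x₀ : Vec d)
            (μ : Measure Ω) [IsProbabilityMeasure μ] (ℱ : Filtration ℕ m)
            (θ : ℕ → Ω → Θ) (ξ : ℕ → Ω → Ξ) (s : ℕ → Ω → Vec d),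
            Assumptions p k → ConvexOn ℝ p.Z p.f →
            x₀ ∈ p.Z → p.g x₀ - p.gStar ≤ εg / 2 → p.f x₀ - p.fStar ≤ Δ →
            IsRun p (stdInput k c δ x₀) μ ℱ θ ξ s →
            ENNReal.ofReal (1 - δ) ≤ μ {ω | ∀ t : ℕ, T ≤ t →
              p.IsOptimal εf εg
                (iterate (stdInput k c δ x₀).γ x₀ (fun i => s i ω) t)}) := by
  refine ⟨10, by norm_num, ?_, ?_⟩
  · intro d Θ Ξ Ω _ _ m p k x₀ εg δ μ _ ℱ θ ξ s hd A hf hx₀ hε hδ0 hδ1 run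
    exact (le_measure_feasible_and_rates hd A hf hx₀ hε hδ0 hδ1 run).trans
      (measure_mono fun ω hω => ⟨hω.1, hω.2.2⟩)
  · intro k Δ
    set R := 1 + |lowerConst k 10| + |upperConst k 10| + |Δ| + |k.Lg * k.D ^ 2| + |k.Lf * k.D ^ 2|
      with hR
    have a1 := abs_nonneg (lowerConst k 10)
    have a2 := abs_nonneg (upperConst k 10)
    have a3 := abs_nonneg Δ
    have a4 := abs_nonneg (k.Lg * k.D ^ 2)
    have a5 := abs_nonneg (k.Lf * k.D ^ 2)
    obtain ⟨M, hM, h⟩ := exists_tolerance R (by linarith)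
    -- Two samples per iteration give the `2`; the `+ 1` pays for rounding `T` up, as
    -- `log(d/(δε))/ε² ≥ 1`.
    refine ⟨2 * (M + 1), by linarith, fun d εf εg δ hd hε0 hε1 hδ0 hδ1 => ?_⟩
    set ε := min εf εg with hε
    have hl := half_le_log_div hd hδ0 hδ1 hε0 hε1
    refine ⟨⌈M * Real.log (d / (δ * ε)) / ε ^ 2⌉₊, ?_, ?_⟩
    · rw [sampleCount_eq]
      push_cast
      have h1 := (Nat.ceil_lt_add_one
        (by positivity : 0 ≤ M * Real.log (d / (δ * ε)) / ε ^ 2)).le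
      have h2 : 1 ≤ Real.log (d / (δ * ε)) / ε ^ 2 := by
        rw [le_div_iff₀ (by positivity)]
        nlinarith
      calc _ ≤ 2 * (M * Real.log (d / (δ * ε)) / ε ^ 2 + Real.log (d / (δ * ε)) / ε ^ 2) := by
            linarith
        _ = _ := by ring
    · intro Θ Ξ Ω _ _ m p x₀ μ _ ℱ θ ξ s A hf hx₀ hg hΔ run
      refine (le_measure_feasible_and_rates hd A hf hx₀ hg hδ0 hδ1 run).trans
        (measure_mono fun ω hω t ht => ?_)
      have ht' := Nat.ceil_le.mp ht
      -- The initial gap enters as `b`: it is `0` below, where the gap is measured from `g x₀`, and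
      -- `Δ` above.
      obtain ⟨ht1, hlow⟩ := h d δ ε t hd hδ0 hδ1 hε0 hε1 ht' (lowerConst k 10) 0 (k.Lg * k.D ^ 2)
        (by linarith) (by rw [abs_zero]; linarith) (by linarith)
      obtain ⟨-, hup⟩ := h d δ ε t hd hδ0 hδ1 hε0 hε1 ht' (upperConst k 10) Δ (k.Lf * k.D ^ 2)
        (by linarith) (by linarith) (by linarith)
      obtain ⟨r1, r2⟩ := hω.2.2 t ht1
      refine ⟨hω.2.1 t, ?_, ?_⟩
      · have h3 : (p.f x₀ - p.fStar + k.Lf * k.D ^ 2 * Real.log t) / ((t : ℝ) + 1) ≤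
            (Δ + k.Lf * k.D ^ 2 * Real.log t) / ((t : ℝ) + 1) := by gcongr
        have := min_le_left εf εg
        linarith
      · rw [zero_add] at hlow
        have := min_le_right εf εg
        linarith
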